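/- Let $a_{11},a_{12},a_{21},a_{22}\in\mathbb R$ satisfy $|a_{12}a_{21}|<|a_{11}a_{22}|$. For a delay $\tau\ge 0$ consider the system $$\dot r(t)=a_{11}r(t-\tau)+a_{12}j(t),\qquad \dot j(t)=a_{21}r(t)+a_{22}j(t),\qquad t\ge 0,$$ with continuous initial data on $[-\tau,0]$. Its zero equilibrium is called stable if it is Lyapunov stable and every solution tends to $(0,0)$ as $t\to\infty$, and unstable if there are arbitrarily small initial data whose solutions are unbounded on $[0,\infty)$. A delay $\tau_0>0$ is called a stability switch if the equilibrium is stable for all $\tau<\tau_0$ close to $\tau_0$ and unstable for all $\tau>\tau_0$ close to $\tau_0$, or vice versa. 1. If the equilibrium is unstable for $\tau=0$, then it is unstable for every $\tau\ge 0$. 2. If the equilibrium is stable for $\tau=0$, then $a_{11}<0$ and there is exactly one stability switch, namely $$\tau_c=\frac1{\omega_0}\arccos\frac{a_{12}a_{21}a_{22}}{a_{11}(\omega_0^2+a_{22}^2)}>0,$$ $$\omega_0=\sqrt{\tfrac12\bigl(a_{11}^2-a_{22}^2-2a_{12}a_{21}+\sqrt{\Delta}\bigr)}>0,\qquad \Delta=(a_{11}^2+a_{22}^2)^2+4a_{12}a_{21}(a_{22}^2-a_{11}^2).$$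 The equilibrium is stable for $0\le\tau<\tau_c$ and unstable for $\tau>\tau_c$, and at $\tau=\tau_c$ a Hopf bifurcation with frequency $\omega_0$ occurs. This means that for $\tau=\tau_c$ the numbers $\pm i\omega_0$ are simple zeros of the characteristic function $$W_\tau(\lambda)=(\lambda-a_{11}e^{-\lambda\tau})(\lambda-a_{22})-a_{12}a_{21}$$ and its only zeros on the imaginary axis; that for $\tau$ near $\tau_c$ there is a $C^1$ branch $\lambda(\tau)$ of zeros of $W_\tau$ with $\lambda(\tau_c)=i\omega_0$ and $\operatorname{Re}\lambda'(\tau_c)\neq 0$; and that for $\tau=\tau_c$ the system has nonconstant periodic solutions of period $2\pi/\omega_0$ of arbitrarily small amplitude. -/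

import Mathlib

open Set Filter Topology

namespace Dyad

/-- `(r, j)` solves the delay system
`r'(t) = a₁₁ r(t - τ) + a₁₂ j(t)`, `j'(t) = a₂₁ r(t) + a₂₂ j(t)` for `t ≥ 0`
(one-sided derivatives at `t = 0`), with continuous initial data on `[-τ, 0]`.
Only the values on `[-τ, ∞)` matter. -/
structure IsSolution (a₁₁ a₁₂ a₂₁ a₂₂ τ : ℝ) (r j : ℝ → ℝ) : Prop where
  continuousOn_r : ContinuousOn r (Ici (-τ))
  continuousOn_j : ContinuousOn j (Ici (-τ))
  deriv_r : ∀ t, 0 ≤ t → HasDerivWithinAt r (a₁₁ * r (t - τ) + a₁₂ * j t) (Ici 0) t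
  deriv_j : ∀ t, 0 ≤ t → HasDerivWithinAt j (a₂₁ * r t + a₂₂ * j t) (Ici 0) t

/-- The initial data of `(r, j)` on `[-τ, 0]` are smaller than `δ` in the supremum norm. -/
def SmallInitialData (τ δ : ℝ) (r j : ℝ → ℝ) : Prop :=
  ∀ t ∈ Icc (-τ) 0, |r t| < δ ∧ |j t| < δ

/-- Lyapunov stability of the zero equilibrium. -/
def IsLyapunovStable (a₁₁ a₁₂ a₂₁ a₂₂ τ : ℝ) : Prop :=
  ∀ ε : ℝ, 0 < ε → ∃ δ : ℝ, 0 < δ ∧ ∀ r j : ℝ → ℝ,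
    IsSolution a₁₁ a₁₂ a₂₁ a₂₂ τ r j → SmallInitialData τ δ r j →
      ∀ t, 0 ≤ t → |r t| < ε ∧ |j t| < ε

/-- The zero equilibrium is stable (that is, asymptotically stable): it is Lyapunov stable and
all solutions tend to it. -/
def IsStable (a₁₁ a₁₂ a₂₁ a₂₂ τ : ℝ) : Prop :=
  IsLyapunovStable a₁₁ a₁₂ a₂₁ a₂₂ τ ∧
    ∀ r j : ℝ → ℝ, IsSolution a₁₁ a₁₂ a₂₁ a₂₂ τ r j →
      Tendsto r atTop (𝓝 0) ∧ Tendsto j atTop (𝓝 0)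

/-- The zero equilibrium is unstable: arbitrarily close to it there are initial data whose
solutions diverge, i.e. are unbounded for `t ≥ 0`. -/
def IsUnstable (a₁₁ a₁₂ a₂₁ a₂₂ τ : ℝ) : Prop :=
  ∀ δ : ℝ, 0 < δ → ∃ r j : ℝ → ℝ,
    IsSolution a₁₁ a₁₂ a₂₁ a₂₂ τ r j ∧ SmallInitialData τ δ r j ∧
      ¬ ∃ M : ℝ, ∀ t, 0 ≤ t → |r t| ≤ M ∧ |j t| ≤ M

/-- A stability switch at the delay `τ₀ > 0`: as `τ` grows through `τ₀`, the equilibrium changes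
from stable to unstable or from unstable to stable. -/
def IsStabilitySwitch (a₁₁ a₁₂ a₂₁ a₂₂ τ₀ : ℝ) : Prop :=
  0 < τ₀ ∧
    (((∀ᶠ τ in 𝓝[<] τ₀, IsStable a₁₁ a₁₂ a₂₁ a₂₂ τ) ∧
        (∀ᶠ τ in 𝓝[>] τ₀, IsUnstable a₁₁ a₁₂ a₂₁ a₂₂ τ)) ∨
      ((∀ᶠ τ in 𝓝[<] τ₀, IsUnstable a₁₁ a₁₂ a₂₁ a₂₂ τ) ∧
        (∀ᶠ τ in 𝓝[>] τ₀, IsStable a₁₁ a₁₂ a₂₁ a₂₂ τ)))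

/-- The characteristic function of the system, whose zeros are its eigenvalues. -/
noncomputable def charFn (a₁₁ a₁₂ a₂₁ a₂₂ τ : ℝ) (z : ℂ) : ℂ :=
  Matrix.det !![z - (a₁₁ : ℂ) * Complex.exp (-(z * (τ : ℂ))), -(a₁₂ : ℂ);
                -(a₂₁ : ℂ), z - (a₂₂ : ℂ)]

/-- A Hopf bifurcation, with frequency `ω > 0`, at the value `τ₀ > 0` of the parameter `τ`:
`± i ω` are simple eigenvalues and there is no other eigenvalue on the imaginary axis; they belong
to a `C¹` branch of eigenvalues which crosses the imaginary axis transversally at `τ₀`; and for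
`τ = τ₀` there are nonconstant periodic solutions of period `2 π / ω` arbitrarily close to the
equilibrium. -/
structure IsHopfBifurcation (a₁₁ a₁₂ a₂₁ a₂₂ τ₀ ω : ℝ) : Prop where
  delay_pos : 0 < τ₀
  freq_pos : 0 < ω
  root : charFn a₁₁ a₁₂ a₂₁ a₂₂ τ₀ ((ω : ℂ) * Complex.I) = 0
  simple : deriv (charFn a₁₁ a₁₂ a₂₁ a₂₂ τ₀) ((ω : ℂ) * Complex.I) ≠ 0
  only_roots : ∀ z : ℂ, charFn a₁₁ a₁₂ a₂₁ a₂₂ τ₀ z = 0 → z.re = 0 →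
    z = (ω : ℂ) * Complex.I ∨ z = -((ω : ℂ) * Complex.I)
  transversal : ∃ z : ℝ → ℂ, z τ₀ = (ω : ℂ) * Complex.I ∧ ContDiffAt ℝ 1 z τ₀ ∧
    (∀ᶠ τ in 𝓝 τ₀, charFn a₁₁ a₁₂ a₂₁ a₂₂ τ (z τ) = 0) ∧ (deriv z τ₀).re ≠ 0
  periodic : ∀ ε : ℝ, 0 < ε → ∃ r j : ℝ → ℝ, IsSolution a₁₁ a₁₂ a₂₁ a₂₂ τ₀ r j ∧
    Function.Periodic r (2 * Real.pi / ω) ∧ Function.Periodic j (2 * Real.pi / ω) ∧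
    (¬ ∃ c d : ℝ, ∀ t, r t = c ∧ j t = d) ∧ ∀ t, |r t| < ε ∧ |j t| < ε

/-- `Δ = (a₁₁² + a₂₂²)² + 4 a₁₂ a₂₁ (a₂₂² - a₁₁²)`. -/
def discr (a₁₁ a₁₂ a₂₁ a₂₂ : ℝ) : ℝ :=
  (a₁₁ ^ 2 + a₂₂ ^ 2) ^ 2 + 4 * (a₁₂ * a₂₁) * (a₂₂ ^ 2 - a₁₁ ^ 2)

/-- `y₀ = (a₁₁² - a₂₂² - 2 a₁₂ a₂₁ + √Δ) / 2`. -/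
noncomputable def critY (a₁₁ a₁₂ a₂₁ a₂₂ : ℝ) : ℝ :=
  (a₁₁ ^ 2 - a₂₂ ^ 2 - 2 * (a₁₂ * a₂₁) + Real.sqrt (discr a₁₁ a₁₂ a₂₁ a₂₂)) / 2

/-- The critical frequency `ω₀ = √y₀`. -/
noncomputable def critFreq (a₁₁ a₁₂ a₂₁ a₂₂ : ℝ) : ℝ :=
  Real.sqrt (critY a₁₁ a₁₂ a₂₁ a₂₂)

/-- `a₀ = a₁₂ a₂₁ a₂₂ / (a₁₁ (ω₀² + a₂₂²))`. -/
noncomputable def critCos (a₁₁ a₁₂ a₂₁ a₂₂ : ℝ) : ℝ :=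
  a₁₂ * a₂₁ * a₂₂ / (a₁₁ * (critFreq a₁₁ a₁₂ a₂₁ a₂₂ ^ 2 + a₂₂ ^ 2))

/-- The critical delay `τ_c = arccos a₀ / ω₀` (for `a₁₁ < 0`). -/
noncomputable def critDelay (a₁₁ a₁₂ a₂₁ a₂₂ : ℝ) : ℝ :=
  Real.arccos (critCos a₁₁ a₁₂ a₂₁ a₂₂) / critFreq a₁₁ a₁₂ a₂₁ a₂₂

end Dyad

/-!
The equilibrium is governed by the zeros of the characteristic function `W τ z = charFn … τ z`.

*From zeros to stability.* A zero with positive real part gives an unbounded exponential solution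
(`isUnstable_of_charFn_eq_zero`). If no zero lies in the closed right half-plane, the equilibrium is
stable (`isStable_of_charFn_ne_zero`). For this, write the system as
`x'(t) = B x(t) + C x(t - τ)` and let `U` be the operator on `C([0, τ])` that advances a solution by
one delay (`stepOp`). For `m ≠ 0` the resolvent equation `m f - U f = g` is an ordinary differential
equation with the matrix `A = B + m⁻¹ C` and a boundary condition, and it is uniquely solvable
unless `m` is an eigenvalue of `exp (τ A)` (`bijective_smul_sub_stepOp`). In that case `A` has an
eigenvalue `z` with `exp (τ z) = m`, and `z` is a zero of `W τ` with `‖m‖ = exp (τ re z)`. Hence the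
spectrum of `U` lies in the open unit disc, and Gelfand's formula gives `U ^ n → 0`.

*Motion of the zeros.* A purely imaginary zero `i ω` has `ω² = critY`, the only positive root of a
quadratic polynomial that is negative at `0`; there the zero is simple and moves to the right as `τ`
grows (`crossing_pos`, `exists_branch`). Zeros in the right half-plane are bounded and persist under
small changes of `τ`, so that they cannot disappear as `τ` grows (`HasUnstableRoot.mono`). This
shows that instability at delay zero persists. In the stable case, imaginary zeros require
`cos (ω₀ τ) = critCos`, so the first delay with a zero in the closed right half-plane is
`critDelay`; from then on there are zeros with positive real part.
-/

open Set Filter Topology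

namespace Dyad

/-! ### Linear differential equations and the step operator -/

section ExtendSeg

variable {X : Type*} [NormedAddCommGroup X]

/-- A function on `[0, τ]`, extended to the real line as a constant on either side. -/
noncomputable def extendSeg {τ : ℝ} (hτ : 0 ≤ τ) (f : C(Icc (0 : ℝ) τ, X)) : ℝ → X :=
  IccExtend hτ f

lemma continuous_extendSeg {τ : ℝ} (hτ : 0 ≤ τ) (f : C(Icc (0 : ℝ) τ, X)) :
    Continuous (extendSeg hτ f) := f.continuous.Icc_extend'

lemma extendSeg_coe {τ : ℝ} (hτ : 0 ≤ τ) (f : C(Icc (0 : ℝ) τ, X)) (s : Icc (0 : ℝ) τ) :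
    extendSeg hτ f s = f s := IccExtend_val hτ f s

lemma norm_extendSeg_le {τ : ℝ} (hτ : 0 ≤ τ) (f : C(Icc (0 : ℝ) τ, X)) (s : ℝ) :
    ‖extendSeg hτ f s‖ ≤ ‖f‖ := f.norm_coe_le_norm _

end ExtendSeg

section LinearDelay

variable {X : Type*} [NormedAddCommGroup X] [NormedSpace ℂ X]

/-- The flow `exp (t A)`, at real times `t`, of the linear equation `x' = A x`. -/
noncomputable def flow (A : X →L[ℂ] X) (t : ℝ) : X →L[ℂ] X := NormedSpace.exp ((t : ℂ) • A)

/-- The solution `s ↦ exp (s A) (x₀ + ∫₀ˢ exp (-u A) h(u) du)` of the inhomogeneous equation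
`y' = A y + h`, `y 0 = x₀`, in the form given by variation of constants. -/
noncomputable def duhamel (A : X →L[ℂ] X) (x₀ : X) (h : ℝ → X) (s : ℝ) : X :=
  flow A s (x₀ + ∫ u in (0 : ℝ)..s, flow A (-u) (h u))

@[simp] lemma flow_zero (A : X →L[ℂ] X) : flow A 0 = 1 := by simp [flow]

@[simp] lemma duhamel_at_zero (A : X →L[ℂ] X) (x₀ : X) (h : ℝ → X) : duhamel A x₀ h 0 = x₀ := by
  simp [duhamel]

lemma duhamel_zero (A : X →L[ℂ] X) (x₀ : X) (s : ℝ) : duhamel A x₀ 0 s = flow A s x₀ := by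
  simp [duhamel]

/-- The solution on `[0, τ]` of `x'(t) = B x(t) + C x(t - τ)` with initial data
`s ↦ f (s + τ)` on `[-τ, 0]`. -/
noncomputable def stepFun (B C : X →L[ℂ] X) {τ : ℝ} (hτ : 0 ≤ τ) (f : C(Icc (0 : ℝ) τ, X)) :
    ℝ → X :=
  duhamel B (extendSeg hτ f τ) fun u => C (extendSeg hτ f u)

lemma stepFun_smul (B C : X →L[ℂ] X) {τ : ℝ} (hτ : 0 ≤ τ) (c : ℂ) (f : C(Icc (0 : ℝ) τ, X))
    (s : ℝ) : stepFun B C hτ (c • f) s = c • stepFun B C hτ f s := by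
  have he : ∀ u, extendSeg hτ (c • f) u = c • extendSeg hτ f u := fun u => rfl
  simp only [stepFun, duhamel, he, map_smul, map_add, smul_add, intervalIntegral.integral_smul]

variable [CompleteSpace X]

lemma flow_mul_flow_neg (A : X →L[ℂ] X) (t : ℝ) : flow A t * flow A (-t) = 1 := by
  let _ : NormedAlgebra ℚ (X →L[ℂ] X) := NormedAlgebra.restrictScalars ℚ ℂ _
  unfold flow
  rw [← NormedSpace.exp_add_of_commute]
  · simp
  · exact ((Commute.refl A).smul_left _).smul_right _

lemma hasDerivAt_flow (A : X →L[ℂ] X) (t : ℝ) : HasDerivAt (flow A) (A * flow A t) t := by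
  simpa using! (hasDerivAt_exp_smul_const' A (t : ℂ)).scomp t Complex.ofRealCLM.hasDerivAt

lemma continuous_flow (A : X →L[ℂ] X) : Continuous (flow A) :=
  continuous_iff_continuousAt.2 fun t => (hasDerivAt_flow A t).continuousAt

lemma hasDerivAt_flow_apply (A : X →L[ℂ] X) {y : ℝ → X} {y' : X} {t : ℝ}
    (hy : HasDerivAt y y' t) :
    HasDerivAt (fun s => flow A s (y s)) (A (flow A t (y t)) + flow A t y') t := by
  have h1 : HasDerivAt (fun s => (flow A s).restrictScalars ℝ)
      ((A * flow A t).restrictScalars ℝ) t :=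
    (ContinuousLinearMap.restrictScalarsL ℂ X X ℝ ℝ).hasFDerivAt.comp_hasDerivAt t
      (hasDerivAt_flow A t)
  exact h1.clm_apply hy

lemma hasDerivAt_duhamel (A : X →L[ℂ] X) (x₀ : X) {h : ℝ → X} (hh : Continuous h) (s : ℝ) :
    HasDerivAt (duhamel A x₀ h) (A (duhamel A x₀ h s) + h s) s := by
  have hc : Continuous fun u => flow A (-u) (h u) :=
    ((continuous_flow A).comp continuous_neg).clm_apply hh
  have h1 := hasDerivAt_flow_apply A
    ((intervalIntegral.integral_hasDerivAt_right (hc.intervalIntegrable 0 s)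
      (hc.stronglyMeasurableAtFilter _ _) hc.continuousAt).const_add x₀)
  have h2 : flow A s (flow A (-s) (h s)) = h s := by
    change (flow A s * flow A (-s)) (h s) = h s
    rw [flow_mul_flow_neg]; simp
  rw [h2] at h1
  exact h1

lemma continuous_duhamel (A : X →L[ℂ] X) (x₀ : X) {h : ℝ → X} (hh : Continuous h) :
    Continuous (duhamel A x₀ h) :=
  continuous_iff_continuousAt.2 fun t => (hasDerivAt_duhamel A x₀ hh t).continuousAt

/-- The inhomogeneous linear equation has at most one solution on `[0, τ]`. -/
lemma eq_duhamel (A : X →L[ℂ] X) {x₀ : X} {h y : ℝ → X} {τ : ℝ} (hh : Continuous h)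
    (hy : ContinuousOn y (Icc 0 τ))
    (hy' : ∀ t ∈ Ico 0 τ, HasDerivWithinAt y (A (y t) + h t) (Ici t) t) (h0 : y 0 = x₀) :
    EqOn y (duhamel A x₀ h) (Icc 0 τ) := by
  refine ODE_solution_unique_of_mem_Icc_right (v := fun t x => A x + h t) (s := fun _ => univ)
    (K := ‖A‖₊) ?_ hy hy' (fun _ _ => mem_univ _) (continuous_duhamel A x₀ hh).continuousOn
    (fun t _ => (hasDerivAt_duhamel A x₀ hh t).hasDerivWithinAt) (fun _ _ => mem_univ _) ?_
  · intro t _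
    refine LipschitzWith.lipschitzOnWith ?_
    refine LipschitzWith.of_dist_le_mul fun x y => ?_
    simpa [dist_eq_norm, ← map_sub] using A.le_opNorm (x - y)
  · simp [h0]

lemma flow_apply_eigenvector {A : X →L[ℂ] X} {v : X} {l : ℂ} (hv : A v = l • v) {t : ℝ}
    (ht : 0 ≤ t) : flow A t v = Complex.exp (l * t) • v := by
  have hd : ∀ s : ℝ, HasDerivAt (fun s : ℝ => Complex.exp (l * s) • v)
      (A (Complex.exp (l * s) • v)) s := by
    intro s
    have h1 : HasDerivAt (fun s : ℝ => Complex.exp (l * s)) (Complex.exp (l * s) * (l * 1)) s :=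
      ((Complex.ofRealCLM.hasDerivAt (x := s)).const_mul l).cexp
    convert! h1.smul_const v using 1
    rw [map_smul, hv, smul_smul, mul_one]
  have h := eq_duhamel A (x₀ := v) (h := 0) (y := fun s : ℝ => Complex.exp (l * s) • v) (τ := t)
    continuous_zero (fun s _ => (hd s).continuousAt.continuousWithinAt)
    (fun s _ => by simpa using (hd s).hasDerivWithinAt) (by simp) (right_mem_Icc.2 ht)
  rw [← duhamel_zero, ← h]

/-- In finite dimension every eigenvalue of `exp (τ A)` comes from an eigenvalue of `A`: its
eigenspace is invariant under `A`, hence contains an eigenvector of `A`. -/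
lemma exists_eigenvector_of_flow [FiniteDimensional ℂ X] {A : X →L[ℂ] X} {w : X} {m : ℂ} {τ : ℝ}
    (hτ : 0 ≤ τ) (hw : w ≠ 0) (h : flow A τ w = m • w) :
    ∃ (l : ℂ) (v : X), v ≠ 0 ∧ A v = l • v ∧ Complex.exp (l * τ) = m := by
  set F : Module.End ℂ X := (flow A τ : X →ₗ[ℂ] X)
  set a : Module.End ℂ X := (A : X →ₗ[ℂ] X)
  have hcomm : Commute (flow A τ) A := by
    let _ : NormedAlgebra ℚ (X →L[ℂ] X) := NormedAlgebra.restrictScalars ℚ ℂ _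
    exact ((Commute.refl A).smul_left _).exp_left
  have hinv : ∀ x ∈ F.eigenspace m, a x ∈ F.eigenspace m := by
    intro x hx
    rw [Module.End.mem_eigenspace_iff] at hx ⊢
    have h1 : flow A τ (A x) = A (flow A τ x) := DFunLike.congr_fun hcomm.eq x
    have h2 : flow A τ x = m • x := hx
    calc F (a x) = A (flow A τ x) := h1
      _ = m • a x := by rw [h2, map_smul]; rfl
  have : Nontrivial (F.eigenspace m) :=
    ⟨⟨w, Module.End.mem_eigenspace_iff.2 h⟩, 0, fun h0 => hw (congrArg Subtype.val h0)⟩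
  obtain ⟨l, hl⟩ := Module.End.exists_eigenvalue (a.restrict hinv)
  obtain ⟨v, hv⟩ := hl.exists_hasEigenvector
  have hv0 : (v : X) ≠ 0 := fun h0 => hv.2 (Subtype.ext h0)
  have hAv : A v = l • (v : X) := congrArg Subtype.val hv.apply_eq_smul
  refine ⟨l, v, hv0, hAv, ?_⟩
  have h1 : flow A τ v = m • (v : X) := Module.End.mem_eigenspace_iff.1 v.2
  rw [flow_apply_eigenvector hAv hτ] at h1
  exact smul_left_injective ℂ hv0 h1

lemma continuous_stepFun (B C : X →L[ℂ] X) {τ : ℝ} (hτ : 0 ≤ τ) (f : C(Icc (0 : ℝ) τ, X)) :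
    Continuous (stepFun B C hτ f) :=
  continuous_duhamel _ _ (C.continuous.comp (continuous_extendSeg hτ f))

lemma exists_bound_stepFun (B C : X →L[ℂ] X) {τ : ℝ} (hτ : 0 ≤ τ) :
    ∃ K, ∀ (f : C(Icc (0 : ℝ) τ, X)), ∀ s ∈ Icc 0 τ, ‖stepFun B C hτ f s‖ ≤ K * ‖f‖ := by
  obtain ⟨K, hK⟩ := (isCompact_Icc (a := -τ) (b := τ)).exists_bound_of_continuousOn
    (continuous_flow B).continuousOn
  have hK0 : 0 ≤ K := (norm_nonneg _).trans (hK 0 ⟨by linarith, hτ⟩)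
  refine ⟨K * (1 + K * ‖C‖ * τ), fun f s hs => ?_⟩
  have h1 : ‖∫ u in (0 : ℝ)..s, flow B (-u) (C (extendSeg hτ f u))‖ ≤
      (K * (‖C‖ * ‖f‖)) * |s - 0| := by
    refine intervalIntegral.norm_integral_le_of_norm_le_const fun u hu => ?_
    rw [uIoc_of_le hs.1] at hu
    refine (ContinuousLinearMap.le_opNorm _ _).trans ?_
    gcongr
    · exact hK _ ⟨by linarith [hu.2, hs.2], by linarith [hu.1]⟩
    · refine (ContinuousLinearMap.le_opNorm _ _).trans ?_
      gcongr
      exact norm_extendSeg_le hτ f u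
  rw [sub_zero, abs_of_nonneg hs.1] at h1
  have h2 : (K * (‖C‖ * ‖f‖)) * s ≤ (K * (‖C‖ * ‖f‖)) * τ := by
    gcongr
    exact hs.2
  calc ‖stepFun B C hτ f s‖ ≤ ‖flow B s‖ *
        ‖extendSeg hτ f τ + ∫ u in (0 : ℝ)..s, flow B (-u) (C (extendSeg hτ f u))‖ :=
        ContinuousLinearMap.le_opNorm _ _
    _ ≤ K * (‖f‖ + (K * (‖C‖ * ‖f‖)) * τ) := by
        gcongr
        · exact hK s ⟨by linarith [hs.1], hs.2⟩
        · exact (norm_add_le _ _).trans (add_le_add (norm_extendSeg_le hτ f τ) (h1.trans h2))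
    _ = K * (1 + K * ‖C‖ * τ) * ‖f‖ := by ring

lemma stepFun_add (B C : X →L[ℂ] X) {τ : ℝ} (hτ : 0 ≤ τ) (f g : C(Icc (0 : ℝ) τ, X)) (s : ℝ) :
    stepFun B C hτ (f + g) s = stepFun B C hτ f s + stepFun B C hτ g s := by
  have hc : ∀ f : C(Icc (0 : ℝ) τ, X), Continuous fun u => flow B (-u) (C (extendSeg hτ f u)) :=
    fun f => ((continuous_flow B).comp continuous_neg).clm_apply
      (C.continuous.comp (continuous_extendSeg hτ f))
  have he : ∀ u, extendSeg hτ (f + g) u = extendSeg hτ f u + extendSeg hτ g u := fun u => rfl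
  simp only [stepFun, duhamel, he, map_add]
  rw [intervalIntegral.integral_add ((hc f).intervalIntegrable _ _)
    ((hc g).intervalIntegrable _ _), map_add]
  abel

/-- The operator on `C([0, τ])` that advances the solutions of `x'(t) = B x(t) + C x(t - τ)` by
one delay. -/
noncomputable def stepOp (B C : X →L[ℂ] X) {τ : ℝ} (hτ : 0 ≤ τ) :
    C(Icc (0 : ℝ) τ, X) →L[ℂ] C(Icc (0 : ℝ) τ, X) :=
  LinearMap.mkContinuousOfExistsBound
    { toFun := fun f => ⟨fun s => stepFun B C hτ f s,
        (continuous_stepFun B C hτ f).comp continuous_subtype_val⟩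
      map_add' := fun f g => by ext s; exact stepFun_add B C hτ f g s
      map_smul' := fun c f => by ext s; exact stepFun_smul B C hτ c f s } (by
    obtain ⟨K, hK⟩ := exists_bound_stepFun B C hτ
    refine ⟨max K 0, fun f => ?_⟩
    rw [ContinuousMap.norm_le _ (by positivity)]
    intro s
    exact (hK f s s.2).trans (by gcongr; exact le_max_left _ _))

lemma stepOp_apply (B C : X →L[ℂ] X) {τ : ℝ} (hτ : 0 ≤ τ) (f : C(Icc (0 : ℝ) τ, X))
    (s : Icc (0 : ℝ) τ) : stepOp B C hτ f s = stepFun B C hτ f s := rfl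

end LinearDelay

/-! ### Stability of linear delay equations -/

section Decay

variable {X : Type*} [NormedAddCommGroup X] [NormedSpace ℂ X]

/-- The resolvent equation `m f - U f = g` of the step operator `U` has a unique solution unless `m`
is an eigenvalue of `exp (τ (B + m⁻¹ C))`. -/
lemma bijective_smul_sub_stepOp [FiniteDimensional ℂ X] [CompleteSpace X] {B C : X →L[ℂ] X}
    {τ : ℝ} (hτ : 0 ≤ τ) {m : ℂ} (hm : m ≠ 0)
    (h : ∀ w, flow (B + m⁻¹ • C) τ w = m • w → w = 0) :
    Function.Bijective fun f => m • f - stepOp B C hτ f := by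
  set A := B + m⁻¹ • C with hA
  have hCc : ∀ f : C(Icc (0 : ℝ) τ, X), Continuous fun u => C (extendSeg hτ f u) :=
    fun f => C.continuous.comp (continuous_extendSeg hτ f)
  have hτm : τ ∈ Icc (0 : ℝ) τ := right_mem_Icc.2 hτ
  constructor
  · -- On an eigenvector the delayed term is `m⁻¹ C x(t)`, so the equation becomes `x' = A x`.
    have key : ∀ f, m • f - stepOp B C hτ f = 0 → f = 0 := by
      intro f hf
      have hfs : ∀ s : Icc (0 : ℝ) τ, m • f s = stepFun B C hτ f s := fun s => by
        have := DFunLike.congr_fun (sub_eq_zero.1 hf) s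
        exact this
      have hfe : ∀ s ∈ Icc (0 : ℝ) τ, extendSeg hτ f s = m⁻¹ • stepFun B C hτ f s := by
        intro s hs
        rw [← hfs ⟨s, hs⟩, smul_smul, inv_mul_cancel₀ hm, one_smul]
        exact extendSeg_coe hτ f ⟨s, hs⟩
      have hsol : EqOn (stepFun B C hτ f) (duhamel A (extendSeg hτ f τ) 0) (Icc 0 τ) := by
        refine eq_duhamel A continuous_zero (continuous_stepFun B C hτ f).continuousOn ?_ ?_
        · intro t ht
          have h1 := (hasDerivAt_duhamel B (extendSeg hτ f τ) (hCc f) t).hasDerivWithinAt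
            (s := Ici t)
          convert! h1 using 1
          rw [hfe t (Ico_subset_Icc_self ht)]
          simp [hA, stepFun]
        · simp [stepFun]
      have h2 := hsol hτm
      rw [duhamel_zero, ← hfs ⟨τ, hτm⟩, ← extendSeg_coe hτ f ⟨τ, hτm⟩] at h2
      have h3 := h _ h2.symm
      ext s
      have h4 := hsol s.2
      rw [duhamel_zero, ← hfs s, h3, map_zero, smul_eq_zero] at h4
      exact h4.resolve_left hm
    intro f g hfg
    refine sub_eq_zero.1 (key (f - g) ?_)
    simp only at hfg
    rw [smul_sub, map_sub, sub_sub_sub_comm, hfg, sub_self]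
  · intro f
    have hsurj : Function.Surjective ((m • LinearMap.id - (flow A τ).toLinearMap : X →ₗ[ℂ] X)) := by
      refine LinearMap.injective_iff_surjective.1 ((injective_iff_map_eq_zero _).2 fun w hw => ?_)
      exact h w (sub_eq_zero.1 hw).symm
    -- The equation `m x - U x = f` says that `g = x - m⁻¹ f` satisfies `g' = A g + m⁻² C f` and the
    -- boundary condition `m (g 0) = g τ + m⁻¹ f τ`.
    set p : ℝ → X := fun u => (m⁻¹ * m⁻¹) • C (extendSeg hτ f u) with hp
    have hpc : Continuous p := (hCc f).const_smul _
    obtain ⟨w, hw⟩ := hsurj (duhamel A 0 p τ + m⁻¹ • extendSeg hτ f τ)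
    have hw' : m • w = duhamel A w p τ + m⁻¹ • extendSeg hτ f τ := by
      have h1 : m • w - flow A τ w = duhamel A 0 p τ + m⁻¹ • extendSeg hτ f τ := hw
      rw [sub_eq_iff_eq_add] at h1
      rw [h1]
      simp only [duhamel, map_add, zero_add]
      abel
    refine ⟨⟨fun s => duhamel A w p s + m⁻¹ • f s,
      ((continuous_duhamel A w hpc).comp continuous_subtype_val).add
        (f.continuous.const_smul _)⟩, ?_⟩
    set x : C(Icc (0 : ℝ) τ, X) := ⟨fun s => duhamel A w p s + m⁻¹ • f s,
      ((continuous_duhamel A w hpc).comp continuous_subtype_val).add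
        (f.continuous.const_smul _)⟩ with hx
    have hxe : ∀ s ∈ Icc (0 : ℝ) τ,
        extendSeg hτ x s = duhamel A w p s + m⁻¹ • extendSeg hτ f s := by
      intro s hs
      rw [extendSeg_coe hτ x ⟨s, hs⟩, extendSeg_coe hτ f ⟨s, hs⟩]
      rfl
    have hsol : EqOn (fun s => m • duhamel A w p s) (stepFun B C hτ x) (Icc 0 τ) := by
      refine eq_duhamel B (hCc x) ((continuous_duhamel A w hpc).const_smul m).continuousOn ?_ ?_
      · intro t ht
        have h1 := ((hasDerivAt_duhamel A w hpc t).const_smul m).hasDerivWithinAt (s := Ici t)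
        convert! h1 using 1
        rw [hxe t (Ico_subset_Icc_self ht)]
        simp only [hA, hp, map_add, map_smul, add_apply, smul_add, smul_smul, smul_apply,
          mul_inv_cancel₀ hm, one_smul, mul_inv_cancel_left₀ hm]
        abel
      · rw [hxe τ hτm, ← hw', duhamel_at_zero]
    ext s
    change m • (duhamel A w p s + m⁻¹ • f s) - stepFun B C hτ x s = f s
    rw [← hsol s.2, smul_add, smul_smul, mul_inv_cancel₀ hm, one_smul, add_sub_cancel_left]

/-- If no exponential solution `e ^ (l t) v` of `x'(t) = B x(t) + C x(t - τ)` has `0 ≤ re l`, then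
the spectrum of the step operator lies in the open unit disc. -/
lemma norm_lt_one_of_mem_spectrum_stepOp [FiniteDimensional ℂ X] [CompleteSpace X]
    {B C : X →L[ℂ] X} {τ : ℝ} (hτ : 0 < τ)
    (h : ∀ (l : ℂ) (v : X), 0 ≤ l.re → l • v = B v + Complex.exp (-(l * τ)) • C v → v = 0)
    {m : ℂ} (hm : m ∈ spectrum ℂ (stepOp B C hτ.le)) : ‖m‖ < 1 := by
  by_contra! hm1
  have hm0 : m ≠ 0 := norm_pos_iff.1 (by linarith)
  refine hm ?_
  change IsUnit (algebraMap ℂ _ m - stepOp B C hτ.le)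
  rw [ContinuousLinearMap.isUnit_iff_bijective]
  refine bijective_smul_sub_stepOp hτ.le hm0 fun w hw => ?_
  by_contra hw0
  obtain ⟨l, v, hv0, hv, hl⟩ := exists_eigenvector_of_flow hτ.le hw0 hw
  refine hv0 (h l v ?_ ?_)
  · have h1 : ‖m‖ = Real.exp (l.re * τ) := by rw [← hl, Complex.norm_exp]; simp
    rw [h1, Real.one_le_exp_iff] at hm1
    exact nonneg_of_mul_nonneg_left hm1 hτ
  · rw [Complex.exp_neg, hl, ← hv]; simp

/-- An operator whose spectrum lies in the open unit disc has powers tending to zero. -/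
lemma tendsto_norm_pow_of_spectrum {A : Type*} [NormedRing A] [NormedAlgebra ℂ A]
    [CompleteSpace A] {a : A} (ha : ∀ m ∈ spectrum ℂ a, ‖m‖ < 1) :
    Tendsto (fun n => ‖a ^ n‖) atTop (𝓝 0) := by
  nontriviality A
  have h1 : spectralRadius ℂ a < (1 : NNReal) :=
    spectrum.spectralRadius_lt_of_forall_lt a fun m hm => by exact_mod_cast ha m hm
  obtain ⟨r, hr1, hr2⟩ := ENNReal.lt_iff_exists_nnreal_btwn.1 h1
  have h2 := (spectrum.pow_nnnorm_pow_one_div_tendsto_nhds_spectralRadius a).eventually_lt_const hr1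
  refine squeeze_zero' (Eventually.of_forall fun _ => norm_nonneg _) ?_
    (tendsto_pow_atTop_nhds_zero_of_lt_one r.coe_nonneg (by exact_mod_cast hr2))
  filter_upwards [h2, eventually_gt_atTop 0] with n hn hn0
  have hn' : (n : ℝ) ≠ 0 := by positivity
  have h3 := ENNReal.rpow_le_rpow hn.le (z := n) (by positivity)
  rw [← ENNReal.rpow_mul, one_div, inv_mul_cancel₀ hn', ENNReal.rpow_one,
    ENNReal.rpow_natCast] at h3
  exact_mod_cast h3

/-- The segment `s ↦ x (n τ - τ + s)`, `0 ≤ s ≤ τ`, of a function on `[-τ, ∞)`. -/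
noncomputable def segment {τ : ℝ} {x : ℝ → X} (hx : ContinuousOn x (Ici (-τ))) (hτ : 0 ≤ τ)
    (n : ℕ) : C(Icc (0 : ℝ) τ, X) :=
  ⟨fun s => x (n * τ - τ + s), by
    refine hx.comp_continuous (by fun_prop) fun s => ?_
    have := s.2.1
    have : 0 ≤ n * τ := by positivity
    rw [mem_Ici]
    linarith⟩

/-- The step operator maps each segment of a solution to the next one. -/
lemma stepOp_segment [CompleteSpace X] {B C : X →L[ℂ] X} {τ : ℝ} (hτ : 0 ≤ τ) {x : ℝ → X}
    (hx : ContinuousOn x (Ici (-τ)))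
    (hx' : ∀ t, 0 ≤ t → HasDerivWithinAt x (B (x t) + C (x (t - τ))) (Ici 0) t) (n : ℕ) :
    stepOp B C hτ (segment hx hτ n) = segment hx hτ (n + 1) := by
  have hn : 0 ≤ n * τ := by positivity
  have he : ∀ s ∈ Icc (0 : ℝ) τ, extendSeg hτ (segment hx hτ n) s = x (n * τ - τ + s) :=
    fun s hs => extendSeg_coe hτ _ ⟨s, hs⟩
  have hsol : EqOn (fun s => x (n * τ + s)) (stepFun B C hτ (segment hx hτ n)) (Icc 0 τ) := by
    refine eq_duhamel B (C.continuous.comp (continuous_extendSeg hτ _)) ?_ ?_ ?_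
    · refine hx.comp (by fun_prop) fun s hs => ?_
      rw [mem_Ici]
      linarith [hs.1]
    · intro t ht
      rw [he t (Ico_subset_Icc_self ht)]
      have h1 := hx' (n * τ + t) (by linarith [ht.1])
      rw [show (n * τ + t - τ : ℝ) = n * τ - τ + t by ring] at h1
      have h2 := h1.scomp (h := fun s => n * τ + s) (s := Ici t) t
        ((hasDerivAt_id t).const_add (n * τ)).hasDerivWithinAt fun s hs => by
          rw [mem_Ici] at hs ⊢
          linarith [ht.1]
      simpa using! h2
    · rw [he τ (right_mem_Icc.2 hτ)]
      simp
  ext s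
  rw [stepOp_apply, ← hsol s.2]
  change x (n * τ + s) = x (((n + 1 : ℕ) : ℝ) * τ - τ + s)
  congr 1
  push_cast
  ring

/-- If no exponential solution `e ^ (l t) v` has `0 ≤ re l`, then the solutions of
`x'(t) = B x(t) + C x(t - τ)` are uniformly bounded by their initial data and tend to zero. -/
theorem delay_stable_of_pos [FiniteDimensional ℂ X] {B C : X →L[ℂ] X} {τ : ℝ} (hτ : 0 < τ)
    (h : ∀ (l : ℂ) (v : X), 0 ≤ l.re → l • v = B v + Complex.exp (-(l * τ)) • C v → v = 0) :
    ∃ K : ℝ, ∀ x : ℝ → X, ContinuousOn x (Ici (-τ)) →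
      (∀ t, 0 ≤ t → HasDerivWithinAt x (B (x t) + C (x (t - τ))) (Ici 0) t) →
      Tendsto x atTop (𝓝 0) ∧
      ∀ M, 0 ≤ M → (∀ t ∈ Icc (-τ) 0, ‖x t‖ ≤ M) → ∀ t, 0 ≤ t → ‖x t‖ ≤ K * M := by
  have : CompleteSpace X := FiniteDimensional.complete ℂ X
  set U := stepOp B C hτ.le with hU
  have hU0 := tendsto_norm_pow_of_spectrum (a := U)
    fun m hm => norm_lt_one_of_mem_spectrum_stepOp hτ h hm
  obtain ⟨K, hK⟩ := hU0.bddAbove_range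
  refine ⟨K, fun x hx hx' => ?_⟩
  have hpow : ∀ n, segment hx hτ.le n = (U ^ n) (segment hx hτ.le 0) := by
    intro n
    induction n with
    | zero => simp
    | succ n ih => rw [← stepOp_segment hτ.le hx hx', ih, pow_succ']; rfl
  have hbound : ∀ t, 0 ≤ t → ‖x t‖ ≤ ‖U ^ (⌊t / τ⌋₊ + 1)‖ * ‖segment hx hτ.le 0‖ := by
    intro t ht
    have h1 := Nat.floor_le (div_nonneg ht hτ.le)
    have h2 := (Nat.lt_floor_add_one (t / τ)).le
    rw [le_div_iff₀ hτ] at h1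
    rw [div_le_iff₀ hτ] at h2
    set n := ⌊t / τ⌋₊
    have h3 : segment hx hτ.le (n + 1) ⟨t - n * τ, by linarith, by linarith⟩ = x t := by
      change x (((n + 1 : ℕ) : ℝ) * τ - τ + (t - n * τ)) = x t
      congr 1
      push_cast
      ring
    rw [← h3]
    refine (ContinuousMap.norm_coe_le_norm _ _).trans ?_
    rw [hpow]
    exact ContinuousLinearMap.le_opNorm _ _
  constructor
  · refine squeeze_zero_norm' (eventually_ge_atTop 0 |>.mono hbound) ?_
    have h1 : Tendsto (fun t : ℝ => ⌊t / τ⌋₊ + 1) atTop atTop :=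
      tendsto_atTop_mono (fun _ => Nat.le_succ _)
        (tendsto_nat_floor_atTop.comp (tendsto_id.atTop_div_const hτ))
    simpa using (hU0.comp h1).mul_const ‖segment hx hτ.le 0‖
  · intro M hM hxM t ht
    refine (hbound t ht).trans ?_
    have h1 : ‖segment hx hτ.le 0‖ ≤ M := by
      rw [ContinuousMap.norm_le _ hM]
      intro s
      refine hxM _ ?_
      have := s.2
      constructor <;> simp <;> [exact this.1; exact this.2]
    have h2 : ‖U ^ (⌊t / τ⌋₊ + 1)‖ ≤ K := hK ⟨_, rfl⟩
    have h3 := (norm_nonneg (U ^ (⌊t / τ⌋₊ + 1))).trans h2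
    gcongr

/-- A linear differential equation without delay is a delay equation with delay `1` and zero
delayed term, which extends the previous theorem to delay zero. -/
theorem delay_stable [FiniteDimensional ℂ X] {B C : X →L[ℂ] X} {τ : ℝ} (hτ : 0 ≤ τ)
    (h : ∀ (l : ℂ) (v : X), 0 ≤ l.re → l • v = B v + Complex.exp (-(l * τ)) • C v → v = 0) :
    ∃ K : ℝ, ∀ x : ℝ → X, ContinuousOn x (Ici (-τ)) →
      (∀ t, 0 ≤ t → HasDerivWithinAt x (B (x t) + C (x (t - τ))) (Ici 0) t) →
      Tendsto x atTop (𝓝 0) ∧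
      ∀ M, 0 ≤ M → (∀ t ∈ Icc (-τ) 0, ‖x t‖ ≤ M) → ∀ t, 0 ≤ t → ‖x t‖ ≤ K * M := by
  rcases hτ.eq_or_lt with rfl | hτ
  · obtain ⟨K, hK⟩ := delay_stable_of_pos (B := B + C) (C := 0) one_pos fun l v hl hv =>
      h l v hl (by simpa using hv)
    refine ⟨K, fun x hx hx' => ?_⟩
    rw [neg_zero] at hx
    have he : ∀ t, 0 ≤ t → x (max t 0) = x t := fun t ht => by rw [max_eq_left ht]
    obtain ⟨h1, h2⟩ := hK (fun t => x (max t 0))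
      (hx.comp_continuous (by fun_prop) fun t => le_max_right t 0).continuousOn (by
        intro t ht
        refine ((hx' t ht).congr (fun s hs => he s hs) (he t ht)).congr_deriv ?_
        simp [ht])
    refine ⟨h1.congr' (eventually_ge_atTop 0 |>.mono he), fun M hM hxM t ht => ?_⟩
    rw [← he t ht]
    refine h2 M hM (fun s hs => ?_) t ht
    simp only [max_eq_right hs.2]
    exact hxM 0 (by simp)
  · exact delay_stable_of_pos hτ h

end Decay

/-! ### Spectral criterion for stability -/

variable {a₁₁ a₁₂ a₂₁ a₂₂ τ : ℝ}

lemma charFn_eq (a₁₁ a₁₂ a₂₁ a₂₂ τ : ℝ) (z : ℂ) : charFn a₁₁ a₁₂ a₂₁ a₂₂ τ z =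
    (z - a₁₁ * Complex.exp (-(z * τ))) * (z - a₂₂) - a₁₂ * a₂₁ := by
  simp [charFn, Matrix.det_fin_two]

/-- The part `(r, j) ↦ (a₁₂ j, a₂₁ r + a₂₂ j)` of the system without delay, over `ℂ`. -/
noncomputable def instantPart (a₁₂ a₂₁ a₂₂ : ℝ) : ℂ × ℂ →L[ℂ] ℂ × ℂ :=
  ((a₁₂ : ℂ) • ContinuousLinearMap.snd ℂ ℂ ℂ).prod
    ((a₂₁ : ℂ) • ContinuousLinearMap.fst ℂ ℂ ℂ + (a₂₂ : ℂ) • ContinuousLinearMap.snd ℂ ℂ ℂ)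

/-- The delayed part `(r, j) ↦ (a₁₁ r, 0)` of the system, over `ℂ`. -/
noncomputable def delayedPart (a₁₁ : ℝ) : ℂ × ℂ →L[ℂ] ℂ × ℂ :=
  ((a₁₁ : ℂ) • ContinuousLinearMap.fst ℂ ℂ ℂ).prod 0

lemma eigenvector_eq_zero {z : ℂ} (hz : charFn a₁₁ a₁₂ a₂₁ a₂₂ τ z ≠ 0) {v : ℂ × ℂ}
    (hv : z • v = instantPart a₁₂ a₂₁ a₂₂ v + Complex.exp (-(z * τ)) • delayedPart a₁₁ v) :
    v = 0 := by
  obtain ⟨c, d⟩ := v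
  have h1 : z * c = a₁₂ * d + Complex.exp (-(z * τ)) * (a₁₁ * c) := congrArg Prod.fst hv
  have h2 : z * d = a₂₁ * c + a₂₂ * d := by
    simpa [instantPart, delayedPart] using congrArg Prod.snd hv
  rw [charFn_eq] at hz
  have hc : ((z - a₁₁ * Complex.exp (-(z * τ))) * (z - a₂₂) - a₁₂ * a₂₁) * c = 0 := by
    linear_combination (z - a₂₂) * h1 + a₁₂ * h2
  have hd : ((z - a₁₁ * Complex.exp (-(z * τ))) * (z - a₂₂) - a₁₂ * a₂₁) * d = 0 := by
    linear_combination (z - a₁₁ * Complex.exp (-(z * τ))) * h2 + a₂₁ * h1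
  rw [mul_eq_zero_iff_left hz] at hc hd
  simp [hc, hd]

lemma IsSolution.hasDerivWithinAt {r j : ℝ → ℝ} (h : IsSolution a₁₁ a₁₂ a₂₁ a₂₂ τ r j) {t : ℝ}
    (ht : 0 ≤ t) : HasDerivWithinAt (fun t => ((r t : ℂ), (j t : ℂ)))
      (instantPart a₁₂ a₂₁ a₂₂ ((r t : ℂ), (j t : ℂ)) +
        delayedPart a₁₁ ((r (t - τ) : ℂ), (j (t - τ) : ℂ))) (Ici 0) t := by
  have h1 := (h.deriv_r t ht).ofReal_comp.prodMk (h.deriv_j t ht).ofReal_comp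
  refine h1.congr_deriv ?_
  ext <;> simp [instantPart, delayedPart]
  ring

/-- **Spectral criterion for stability.** If no zero of the characteristic function lies in the
closed right half-plane, the equilibrium is asymptotically stable. -/
theorem isStable_of_charFn_ne_zero (hτ : 0 ≤ τ)
    (h : ∀ z : ℂ, 0 ≤ z.re → charFn a₁₁ a₁₂ a₂₁ a₂₂ τ z ≠ 0) : IsStable a₁₁ a₁₂ a₂₁ a₂₂ τ := by
  obtain ⟨K, hK⟩ := delay_stable hτ fun z v hz hv => eigenvector_eq_zero (h z hz) hv
  have hsol : ∀ r j : ℝ → ℝ, IsSolution a₁₁ a₁₂ a₂₁ a₂₂ τ r j → _ := fun r j hrj =>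
    hK (fun t => ((r t : ℂ), (j t : ℂ)))
      ((Complex.continuous_ofReal.comp_continuousOn hrj.continuousOn_r).prodMk
        (Complex.continuous_ofReal.comp_continuousOn hrj.continuousOn_j))
      fun t ht => hrj.hasDerivWithinAt ht
  have hle : ∀ a b : ℝ, |a| ≤ ‖((a : ℂ), (b : ℂ))‖ ∧ |b| ≤ ‖((a : ℂ), (b : ℂ))‖ := by
    intro a b
    simp [Prod.norm_def]
  refine ⟨fun ε hε => ⟨ε / (|K| + 1), by positivity, fun r j hrj hs t ht => ?_⟩, fun r j hrj => ?_⟩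
  · have h1 := (hsol r j hrj).2 (ε / (|K| + 1)) (by positivity) (fun s hs' => by
      simpa [Prod.norm_def] using ⟨(hs s hs').1.le, (hs s hs').2.le⟩) t ht
    have h2 : K * (ε / (|K| + 1)) < ε := by
      rw [mul_div_assoc', div_lt_iff₀ (by positivity)]
      nlinarith [le_abs_self K]
    exact ⟨((hle _ _).1.trans h1).trans_lt h2, ((hle _ _).2.trans h1).trans_lt h2⟩
  · have h1 := (hsol r j hrj).1.norm
    rw [norm_zero] at h1
    exact ⟨squeeze_zero_norm (fun t => (hle (r t) (j t)).1) h1,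
      squeeze_zero_norm (fun t => (hle (r t) (j t)).2) h1⟩

lemma IsStable.not_isUnstable (hτ : 0 ≤ τ) (h : IsStable a₁₁ a₁₂ a₂₁ a₂₂ τ) :
    ¬ IsUnstable a₁₁ a₁₂ a₂₁ a₂₂ τ := by
  intro hu
  obtain ⟨r, j, hrj, -, hM⟩ := hu 1 one_pos
  obtain ⟨hr, hj⟩ := h.2 r j hrj
  have key : ∀ f : ℝ → ℝ, ContinuousOn f (Ici (-τ)) → Tendsto f atTop (𝓝 0) →
      ∃ M, ∀ t, 0 ≤ t → |f t| ≤ M := by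
    intro f hf hf0
    obtain ⟨T, hT⟩ := eventually_atTop.1 (hf0.norm.eventually_le_const
      (show ‖(0 : ℝ)‖ < 1 by simp))
    obtain ⟨M, hM⟩ := (isCompact_Icc (a := 0) (b := T)).exists_bound_of_continuousOn
      (hf.mono fun t ht => by rw [mem_Ici]; linarith [ht.1])
    refine ⟨max 1 M, fun t ht => ?_⟩
    rcases le_total T t with h1 | h1
    · exact (hT t h1).trans (le_max_left _ _)
    · exact (hM t ⟨ht, h1⟩).trans (le_max_right _ _)
  obtain ⟨M, hMr⟩ := key r hrj.continuousOn_r hr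
  obtain ⟨N, hNj⟩ := key j hrj.continuousOn_j hj
  exact hM ⟨max M N, fun t ht => ⟨(hMr t ht).trans (le_max_left _ _),
    (hNj t ht).trans (le_max_right _ _)⟩⟩

/-! ### Exponential solutions -/

/-- A zero `z` of the characteristic function has an amplitude `(c, d) ≠ 0` for which
`e ^ (z t) (c, d)` solves the system. -/
lemma exists_eigenvector {z : ℂ} (hz : charFn a₁₁ a₁₂ a₂₁ a₂₂ τ z = 0) :
    ∃ c d : ℂ, (c ≠ 0 ∨ d ≠ 0) ∧ z * c = a₁₁ * (Complex.exp (-(z * τ)) * c) + a₁₂ * d ∧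
      z * d = a₂₁ * c + a₂₂ * d := by
  obtain ⟨v, hv0, hv⟩ := Matrix.exists_mulVec_eq_zero_iff.2 hz
  refine ⟨v 0, v 1, ?_, ?_, ?_⟩
  · by_contra! h
    exact hv0 (by ext i; fin_cases i <;> simp [h])
  · have := congrFun hv 0
    simp [Matrix.mulVec, dotProduct, Fin.sum_univ_two] at this
    linear_combination this
  · have := congrFun hv 1
    simp [Matrix.mulVec, dotProduct, Fin.sum_univ_two] at this
    linear_combination this

lemma hasDerivAt_re_exp (z c : ℂ) (t : ℝ) :
    HasDerivAt (fun t : ℝ => (c * Complex.exp (z * t)).re) (z * c * Complex.exp (z * t)).re t := by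
  have h1 : HasDerivAt (fun t : ℝ => Complex.exp (z * t)) (Complex.exp (z * t) * (z * 1)) t :=
    ((Complex.ofRealCLM.hasDerivAt (x := t)).const_mul z).cexp
  have h2 := Complex.reCLM.hasFDerivAt.comp_hasDerivAt t (h1.const_mul c)
  refine h2.congr_deriv ?_
  rw [Complex.reCLM_apply]
  ring_nf

lemma isSolution_re_exp {z c d : ℂ} (k : ℂ)
    (h1 : z * c = a₁₁ * (Complex.exp (-(z * τ)) * c) + a₁₂ * d) (h2 : z * d = a₂₁ * c + a₂₂ * d) :
    IsSolution a₁₁ a₁₂ a₂₁ a₂₂ τ (fun t => (k * c * Complex.exp (z * t)).re)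
      (fun t => (k * d * Complex.exp (z * t)).re) where
  continuousOn_r := fun t _ => (hasDerivAt_re_exp z (k * c) t).continuousAt.continuousWithinAt
  continuousOn_j := fun t _ => (hasDerivAt_re_exp z (k * d) t).continuousAt.continuousWithinAt
  deriv_r t _ := by
    refine ((hasDerivAt_re_exp z (k * c) t).congr_deriv ?_).hasDerivWithinAt
    rw [← Complex.re_ofReal_mul, ← Complex.re_ofReal_mul, ← Complex.add_re]
    have he : Complex.exp (z * (t - τ : ℝ)) = Complex.exp (z * t) * Complex.exp (-(z * τ)) := by
      rw [← Complex.exp_add]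
      push_cast
      ring_nf
    rw [he]
    congr 1
    linear_combination (k * Complex.exp (z * t)) * h1
  deriv_j t _ := by
    refine ((hasDerivAt_re_exp z (k * d) t).congr_deriv ?_).hasDerivWithinAt
    rw [← Complex.re_ofReal_mul, ← Complex.re_ofReal_mul, ← Complex.add_re]
    congr 1
    linear_combination (k * Complex.exp (z * t)) * h2

/-- A growing exponential is bounded in its real part for the amplitudes `c` and `i c` only if
`c = 0`. -/
lemma eq_zero_of_re_exp_bounded {z c : ℂ} (hz : 0 < z.re) {M : ℝ}
    (h1 : ∀ t : ℝ, 0 ≤ t → |(c * Complex.exp (z * t)).re| ≤ M)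
    (h2 : ∀ t : ℝ, 0 ≤ t → |(Complex.I * c * Complex.exp (z * t)).re| ≤ M) : c = 0 := by
  by_contra hc
  have h3 : ∀ t : ℝ, 0 ≤ t → ‖c‖ * Real.exp (z.re * t) ≤ 2 * M := by
    intro t ht
    have h4 := h2 t ht
    rw [mul_assoc, Complex.I_mul_re, abs_neg] at h4
    have h5 := Complex.norm_le_abs_re_add_abs_im (c * Complex.exp (z * t))
    rw [norm_mul, Complex.norm_exp, Complex.re_mul_ofReal] at h5
    linarith [h1 t ht]
  have h4 : Tendsto (fun t : ℝ => ‖c‖ * Real.exp (z.re * t)) atTop atTop :=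
    (Real.tendsto_exp_atTop.comp (tendsto_id.const_mul_atTop hz)).const_mul_atTop
      (norm_pos_iff.2 hc)
  obtain ⟨t, ht, ht'⟩ := ((eventually_ge_atTop 0).and (h4.eventually_gt_atTop (2 * M))).exists
  linarith [h3 t ht]

lemma abs_re_mul_exp_le {z : ℂ} (k c : ℂ) {t : ℝ} (h : z.re * t ≤ 0) :
    |(k * c * Complex.exp (z * t)).re| ≤ ‖k‖ * ‖c‖ := by
  refine (Complex.abs_re_le_norm _).trans ?_
  rw [norm_mul, norm_mul, Complex.norm_exp, Complex.re_mul_ofReal]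
  exact mul_le_of_le_one_right (by positivity) (Real.exp_le_one_iff.2 h)

/-- **Spectral criterion for instability.** If `e ^ (z t) v` is a complex solution, then its real
part or that of `i e ^ (z t) v` is unbounded. -/
theorem isUnstable_of_charFn_eq_zero {z : ℂ} (hz : 0 < z.re)
    (h : charFn a₁₁ a₁₂ a₂₁ a₂₂ τ z = 0) : IsUnstable a₁₁ a₁₂ a₂₁ a₂₂ τ := by
  intro δ hδ
  obtain ⟨c, d, hcd, h1, h2⟩ := exists_eigenvector h
  set s : ℝ := δ / (‖c‖ + ‖d‖ + 1) with hs
  have hs0 : 0 < s := by positivity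
  have hsδ : s * (‖c‖ + ‖d‖ + 1) = δ := by rw [hs]; field_simp
  have hnorm : ‖(s : ℂ)‖ = s := by simp [abs_of_pos hs0]
  have small : ∀ k : ℂ, ‖k‖ = s → SmallInitialData τ δ (fun t => (k * c * Complex.exp (z * t)).re)
      (fun t => (k * d * Complex.exp (z * t)).re) := by
    intro k hk t ht
    have hzt : z.re * t ≤ 0 := mul_nonpos_of_nonneg_of_nonpos hz.le ht.2
    have hc := abs_re_mul_exp_le k c hzt
    have hd := abs_re_mul_exp_le k d hzt
    rw [hk] at hc hd
    have := mul_nonneg hs0.le (norm_nonneg c)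
    have := mul_nonneg hs0.le (norm_nonneg d)
    constructor <;> nlinarith
  by_contra! hcon
  obtain ⟨M, hM⟩ := hcon _ _ (isSolution_re_exp s h1 h2) (small s hnorm)
  obtain ⟨N, hN⟩ := hcon _ _ (isSolution_re_exp (Complex.I * s) h1 h2)
    (small _ (by rw [norm_mul, Complex.norm_I, one_mul, hnorm]))
  have key : ∀ w : ℂ, (∀ t : ℝ, 0 ≤ t → |(s * w * Complex.exp (z * t)).re| ≤ M) →
      (∀ t : ℝ, 0 ≤ t → |(Complex.I * s * w * Complex.exp (z * t)).re| ≤ N) → w = 0 := by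
    intro w hw1 hw2
    have h3 := eq_zero_of_re_exp_bounded (c := s * w) (M := max M N) hz
      (fun t ht => (hw1 t ht).trans (le_max_left _ _))
      (fun t ht => by rw [← mul_assoc]; exact (hw2 t ht).trans (le_max_right _ _))
    exact (mul_eq_zero.1 h3).resolve_left (by exact_mod_cast hs0.ne')
  rcases hcd with hc | hd
  · exact hc (key c (fun t ht => (hM t ht).1) fun t ht => (hN t ht).1)
  · exact hd (key d (fun t ht => (hM t ht).2) fun t ht => (hN t ht).2)

lemma exists_periodic_solutions {ω : ℝ} (hω : 0 < ω)
    (h : charFn a₁₁ a₁₂ a₂₁ a₂₂ τ (ω * Complex.I) = 0) {ε : ℝ} (hε : 0 < ε) :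
    ∃ r j : ℝ → ℝ, IsSolution a₁₁ a₁₂ a₂₁ a₂₂ τ r j ∧
    Function.Periodic r (2 * Real.pi / ω) ∧ Function.Periodic j (2 * Real.pi / ω) ∧
    (¬ ∃ c d : ℝ, ∀ t, r t = c ∧ j t = d) ∧ ∀ t, |r t| < ε ∧ |j t| < ε := by
  obtain ⟨c, d, hcd, h1, h2⟩ := exists_eigenvector h
  set s : ℝ := ε / (‖c‖ + ‖d‖ + 1) with hs
  have hs0 : 0 < s := by positivity
  have hsε : s * (‖c‖ + ‖d‖ + 1) = ε := by rw [hs]; field_simp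
  have hnorm : ‖(s : ℂ)‖ = s := by simp [abs_of_pos hs0]
  have hper : ∀ w : ℂ, Function.Periodic
      (fun t : ℝ => (s * w * Complex.exp (ω * Complex.I * t)).re) (2 * Real.pi / ω) := by
    intro w t
    have hωc : (ω : ℂ) ≠ 0 := by exact_mod_cast hω.ne'
    have : (ω * Complex.I * (t + 2 * Real.pi / ω : ℝ) : ℂ) =
        ω * Complex.I * t + 2 * Real.pi * Complex.I := by
      push_cast
      field_simp
    simp only [this, Complex.exp_periodic _]
  -- The first and the second derivative at `0` determine the amplitude `w`.
  have hconst : ∀ w : ℂ, (∃ e : ℝ, ∀ t : ℝ, (s * w * Complex.exp (ω * Complex.I * t)).re = e) →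
      w = 0 := by
    rintro w ⟨e, he⟩
    have hd : ∀ t : ℝ, (ω * Complex.I * (s * w) * Complex.exp (ω * Complex.I * t)).re = 0 := by
      intro t
      have h3 := hasDerivAt_re_exp (ω * Complex.I) (s * w) t
      simp only [he] at h3
      exact h3.unique (hasDerivAt_const t e)
    have hd2 : ∀ t : ℝ, (ω * Complex.I * (ω * Complex.I * (s * w)) *
        Complex.exp (ω * Complex.I * t)).re = 0 := by
      intro t
      have h3 := hasDerivAt_re_exp (ω * Complex.I) (ω * Complex.I * (s * w)) t
      simp only [hd] at h3
      exact h3.unique (hasDerivAt_const t 0)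
    have h4 := hd 0
    have h5 := hd2 0
    simp [hω.ne', hs0.ne'] at h4 h5
    exact Complex.ext h5 h4
  refine ⟨_, _, isSolution_re_exp s h1 h2, hper c, hper d, ?_, fun t => ?_⟩
  · rintro ⟨e, f, hef⟩
    rcases hcd with hc | hd
    · exact hc (hconst c ⟨e, fun t => (hef t).1⟩)
    · exact hd (hconst d ⟨f, fun t => (hef t).2⟩)
  · have hzt : ((ω : ℂ) * Complex.I).re * t ≤ 0 := by simp
    have hc := abs_re_mul_exp_le s c hzt
    have hd := abs_re_mul_exp_le s d hzt
    rw [hnorm] at hc hd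
    have := mul_nonneg hs0.le (norm_nonneg c)
    have := mul_nonneg hs0.le (norm_nonneg d)
    constructor <;> nlinarith

/-! ### Imaginary zeros of the characteristic function -/

variable {ω : ℝ}

lemma charFn_imag_eq_zero_iff : charFn a₁₁ a₁₂ a₂₁ a₂₂ τ (ω * Complex.I) = 0 ↔
    a₁₁ * a₂₂ * Real.cos (ω * τ) - a₁₁ * ω * Real.sin (ω * τ) = ω ^ 2 + a₁₂ * a₂₁ ∧
    a₁₁ * ω * Real.cos (ω * τ) + a₁₁ * a₂₂ * Real.sin (ω * τ) = -(ω * a₂₂) := by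
  have he : Complex.exp (-(ω * Complex.I * τ)) =
      (Real.cos (ω * τ) : ℂ) - Real.sin (ω * τ) * Complex.I := by
    rw [show -((ω : ℂ) * Complex.I * τ) = -((ω * τ : ℝ) : ℂ) * Complex.I by push_cast; ring,
      Complex.exp_mul_I, Complex.cos_neg, Complex.sin_neg, Complex.ofReal_cos, Complex.ofReal_sin]
    ring
  rw [charFn_eq, he, Complex.ext_iff]
  simp only [Complex.sub_re, Complex.mul_re, Complex.ofReal_re, Complex.I_re, Complex.ofReal_im,
    Complex.I_im, Complex.sub_im, Complex.mul_im, Complex.zero_re, Complex.zero_im]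
  constructor
  · rintro ⟨h1, h2⟩
    constructor <;> linarith
  · rintro ⟨h1, h2⟩
    constructor <;> linarith

lemma sq_lt_sq_of_abs (h : |a₁₂ * a₂₁| < |a₁₁ * a₂₂|) : (a₁₂ * a₂₁) ^ 2 < (a₁₁ * a₂₂) ^ 2 :=
  sq_lt_sq.2 h

lemma ne_zero_of_abs (h : |a₁₂ * a₂₁| < |a₁₁ * a₂₂|) : a₁₁ ≠ 0 ∧ a₂₂ ≠ 0 :=
  mul_ne_zero_iff.1 (abs_pos.1 ((abs_nonneg _).trans_lt h))

/-- The squared frequency `ω²` of an imaginary zero is a root of a quadratic polynomial, obtained by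
eliminating the delay through `cos² + sin² = 1`. Its value at zero is
`(a₁₂ a₂₁)² - (a₁₁ a₂₂)² < 0`. -/
lemma freq_quadratic (h0 : charFn a₁₁ a₁₂ a₂₁ a₂₂ τ (ω * Complex.I) = 0) :
    (ω ^ 2 + a₁₂ * a₂₁) ^ 2 + ω ^ 2 * a₂₂ ^ 2 = a₁₁ ^ 2 * (ω ^ 2 + a₂₂ ^ 2) := by
  obtain ⟨h1, h2⟩ := charFn_imag_eq_zero_iff.1 h0
  rw [← h1, show ω ^ 2 * a₂₂ ^ 2 = (-(ω * a₂₂)) ^ 2 by ring, ← h2]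
  linear_combination a₁₁ ^ 2 * (ω ^ 2 + a₂₂ ^ 2) * Real.cos_sq_add_sin_sq (ω * τ)

lemma freq_ne_zero (h : |a₁₂ * a₂₁| < |a₁₁ * a₂₂|)
    (h0 : charFn a₁₁ a₁₂ a₂₁ a₂₂ τ (ω * Complex.I) = 0) : ω ≠ 0 := by
  rintro rfl
  have h1 := freq_quadratic h0
  have h2 := sq_lt_sq_of_abs h
  nlinarith

/-- The quadratic polynomial of `freq_quadratic` is negative at zero, hence `critY` is its only
positive root. -/
lemma eq_critY (h : |a₁₂ * a₂₁| < |a₁₁ * a₂₂|) {y : ℝ} (hy : 0 < y)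
    (hq : (y + a₁₂ * a₂₁) ^ 2 + y * a₂₂ ^ 2 = a₁₁ ^ 2 * (y + a₂₂ ^ 2)) :
    y = critY a₁₁ a₁₂ a₂₁ a₂₂ := by
  have h2 := sq_lt_sq_of_abs h
  have h3 : 0 < 2 * y + (2 * (a₁₂ * a₂₁) + a₂₂ ^ 2 - a₁₁ ^ 2) := by
    by_contra! hc
    nlinarith [mul_nonneg hy.le (neg_nonneg.2 hc)]
  have h4 : discr a₁₁ a₁₂ a₂₁ a₂₂ =
      (2 * y + (2 * (a₁₂ * a₂₁) + a₂₂ ^ 2 - a₁₁ ^ 2)) ^ 2 := by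
    unfold discr
    linear_combination -4 * hq
  rw [critY, h4, Real.sqrt_sq h3.le]
  ring

lemma critY_pos (h : |a₁₂ * a₂₁| < |a₁₁ * a₂₂|) : 0 < critY a₁₁ a₁₂ a₂₁ a₂₂ := by
  have h2 := sq_lt_sq_of_abs h
  have h3 : |2 * (a₁₂ * a₂₁) + a₂₂ ^ 2 - a₁₁ ^ 2| < √(discr a₁₁ a₁₂ a₂₁ a₂₂) := by
    refine Real.lt_sqrt_of_sq_lt ?_
    rw [sq_abs]
    unfold discr
    nlinarith
  have h4 := (le_abs_self _).trans_lt h3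
  unfold critY
  linarith

lemma critY_quadratic (h : |a₁₂ * a₂₁| < |a₁₁ * a₂₂|) :
    (critY a₁₁ a₁₂ a₂₁ a₂₂ + a₁₂ * a₂₁) ^ 2 + critY a₁₁ a₁₂ a₂₁ a₂₂ * a₂₂ ^ 2 =
      a₁₁ ^ 2 * (critY a₁₁ a₁₂ a₂₁ a₂₂ + a₂₂ ^ 2) := by
  have h2 := sq_lt_sq_of_abs h
  have h3 : √(discr a₁₁ a₁₂ a₂₁ a₂₂) ^ 2 = discr a₁₁ a₁₂ a₂₁ a₂₂ := by
    refine Real.sq_sqrt ?_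
    have : discr a₁₁ a₁₂ a₂₁ a₂₂ = (2 * (a₁₂ * a₂₁) + a₂₂ ^ 2 - a₁₁ ^ 2) ^ 2 +
        4 * ((a₁₁ * a₂₂) ^ 2 - (a₁₂ * a₂₁) ^ 2) := by
      unfold discr
      ring
    rw [this]
    have := sub_pos.2 h2
    positivity
  unfold critY
  set s := √(discr a₁₁ a₁₂ a₂₁ a₂₂)
  unfold discr at h3
  linear_combination h3 / 4

lemma critFreq_pos (h : |a₁₂ * a₂₁| < |a₁₁ * a₂₂|) : 0 < critFreq a₁₁ a₁₂ a₂₁ a₂₂ :=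
  Real.sqrt_pos.2 (critY_pos h)

lemma critFreq_sq (h : |a₁₂ * a₂₁| < |a₁₁ * a₂₂|) :
    critFreq a₁₁ a₁₂ a₂₁ a₂₂ ^ 2 = critY a₁₁ a₁₂ a₂₁ a₂₂ := Real.sq_sqrt (critY_pos h).le

lemma abs_eq_critFreq (h : |a₁₂ * a₂₁| < |a₁₁ * a₂₂|)
    (h0 : charFn a₁₁ a₁₂ a₂₁ a₂₂ τ (ω * Complex.I) = 0) : |ω| = critFreq a₁₁ a₁₂ a₂₁ a₂₂ := by
  have := freq_ne_zero h h0
  rw [critFreq, ← eq_critY h (by positivity) (freq_quadratic h0), Real.sqrt_sq_eq_abs]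

lemma cos_eq_critCos (h : |a₁₂ * a₂₁| < |a₁₁ * a₂₂|)
    (h0 : charFn a₁₁ a₁₂ a₂₁ a₂₂ τ (ω * Complex.I) = 0) :
    Real.cos (critFreq a₁₁ a₁₂ a₂₁ a₂₂ * τ) = critCos a₁₁ a₁₂ a₂₁ a₂₂ := by
  obtain ⟨h11, h22⟩ := ne_zero_of_abs h
  obtain ⟨h1, h2⟩ := charFn_imag_eq_zero_iff.1 h0
  have hc : Real.cos (critFreq a₁₁ a₁₂ a₂₁ a₂₂ * τ) = Real.cos (ω * τ) := by
    rw [← abs_eq_critFreq h h0]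
    rcases abs_choice ω with h3 | h3 <;> rw [h3]
    rw [neg_mul, Real.cos_neg]
  have hd : ω ^ 2 + a₂₂ ^ 2 ≠ 0 := by positivity
  rw [hc, critCos, ← abs_eq_critFreq h h0, sq_abs, eq_div_iff (mul_ne_zero h11 hd)]
  linear_combination a₂₂ * h1 + ω * h2

/-- The sine that an imaginary zero at frequency `ω₀` requires besides the cosine `critCos` is
positive for `a₁₁ < 0`, which is why the critical angle is the arccosine of `critCos`. -/
lemma exists_sin_critCos (h : |a₁₂ * a₂₁| < |a₁₁ * a₂₂|) (h11 : a₁₁ < 0) :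
    ∃ s : ℝ, 0 < s ∧ critCos a₁₁ a₁₂ a₂₁ a₂₂ ^ 2 + s ^ 2 = 1 ∧
      a₁₁ * (critFreq a₁₁ a₁₂ a₂₁ a₂₂ ^ 2 + a₂₂ ^ 2) * s =
        -(critFreq a₁₁ a₁₂ a₂₁ a₂₂ * (critFreq a₁₁ a₁₂ a₂₁ a₂₂ ^ 2 + a₁₂ * a₂₁ + a₂₂ ^ 2)) := by
  have hω := critFreq_pos h
  have hq := critY_quadratic h
  have hy : a₁₁ ^ 2 + a₂₂ ^ 2 ≤ 2 * (critY a₁₁ a₁₂ a₂₁ a₂₂ + a₁₂ * a₂₁ + a₂₂ ^ 2) := by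
    have := Real.sqrt_nonneg (discr a₁₁ a₁₂ a₂₁ a₂₂)
    unfold critY
    linarith
  rw [← critFreq_sq h] at hq hy
  unfold critCos
  set w := critFreq a₁₁ a₁₂ a₂₁ a₂₂
  have h22 := (ne_zero_of_abs h).2
  have hpos : 0 < w ^ 2 + a₁₂ * a₂₁ + a₂₂ ^ 2 := by
    have : 0 < a₁₁ ^ 2 + a₂₂ ^ 2 := by positivity
    linarith
  have hd : a₁₁ * (w ^ 2 + a₂₂ ^ 2) < 0 := mul_neg_of_neg_of_pos h11 (by positivity)
  refine ⟨-(w * (w ^ 2 + a₁₂ * a₂₁ + a₂₂ ^ 2)) / (a₁₁ * (w ^ 2 + a₂₂ ^ 2)),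
    div_pos_of_neg_of_neg (neg_neg_of_pos (by positivity)) hd, ?_, ?_⟩
  · rw [div_pow, div_pow, ← add_div, div_eq_one_iff_eq (pow_ne_zero 2 hd.ne)]
    linear_combination (w ^ 2 + a₂₂ ^ 2) * hq
  · rw [mul_div_cancel₀ _ hd.ne]

lemma critCos_mem (h : |a₁₂ * a₂₁| < |a₁₁ * a₂₂|) (h11 : a₁₁ < 0) :
    -1 ≤ critCos a₁₁ a₁₂ a₂₁ a₂₂ ∧ critCos a₁₁ a₁₂ a₂₁ a₂₂ < 1 := by
  obtain ⟨s, hs, h1, -⟩ := exists_sin_critCos h h11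
  constructor <;> nlinarith [pow_pos hs 2]

lemma critDelay_pos (h : |a₁₂ * a₂₁| < |a₁₁ * a₂₂|) (h11 : a₁₁ < 0) :
    0 < critDelay a₁₁ a₁₂ a₂₁ a₂₂ :=
  div_pos (Real.arccos_pos.2 (critCos_mem h h11).2) (critFreq_pos h)

lemma charFn_critDelay (h : |a₁₂ * a₂₁| < |a₁₁ * a₂₂|) (h11 : a₁₁ < 0) :
    charFn a₁₁ a₁₂ a₂₁ a₂₂ (critDelay a₁₁ a₁₂ a₂₁ a₂₂)
      (critFreq a₁₁ a₁₂ a₂₁ a₂₂ * Complex.I) = 0 := by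
  obtain ⟨s, hs, h1, h2⟩ := exists_sin_critCos h h11
  have hω := critFreq_pos h
  have hm := critCos_mem h h11
  have h22 := (ne_zero_of_abs h).2
  rw [charFn_imag_eq_zero_iff, critDelay, mul_div_cancel₀ _ hω.ne', Real.sin_arccos,
    Real.cos_arccos hm.1 hm.2.le, show 1 - critCos a₁₁ a₁₂ a₂₁ a₂₂ ^ 2 = s ^ 2 by linarith,
    Real.sqrt_sq hs.le]
  have hd : critFreq a₁₁ a₁₂ a₂₁ a₂₂ ^ 2 + a₂₂ ^ 2 ≠ 0 := by positivity
  have h3 : a₁₁ * (critFreq a₁₁ a₁₂ a₂₁ a₂₂ ^ 2 + a₂₂ ^ 2) * critCos a₁₁ a₁₂ a₂₁ a₂₂ =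
      a₁₂ * a₂₁ * a₂₂ := by
    rw [critCos, mul_div_cancel₀ _ (mul_ne_zero h11.ne hd)]
  constructor
  · refine mul_left_cancel₀ hd ?_
    linear_combination a₂₂ * h3 - critFreq a₁₁ a₁₂ a₂₁ a₂₂ * h2
  · refine mul_left_cancel₀ hd ?_
    linear_combination critFreq a₁₁ a₁₂ a₂₁ a₂₂ * h3 + a₂₂ * h2

/-- There are no imaginary zeros before the critical delay, since the cosine is injective on
`[0, π]`. -/
lemma critDelay_le (h : |a₁₂ * a₂₁| < |a₁₁ * a₂₂|) (hτ : 0 ≤ τ)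
    (h0 : charFn a₁₁ a₁₂ a₂₁ a₂₂ τ (ω * Complex.I) = 0) :
    critDelay a₁₁ a₁₂ a₂₁ a₂₂ ≤ τ := by
  have hω := critFreq_pos h
  rw [critDelay, div_le_iff₀ hω, ← cos_eq_critCos h h0, mul_comm τ]
  have h1 : 0 ≤ critFreq a₁₁ a₁₂ a₂₁ a₂₂ * τ := by positivity
  rcases le_total (critFreq a₁₁ a₁₂ a₂₁ a₂₂ * τ) Real.pi with h2 | h2
  · rw [Real.arccos_cos h1 h2]
  · exact (Real.arccos_le_pi _).trans h2

/-! ### Zeros near the imaginary axis -/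

lemma contDiff_charFn (a₁₁ a₁₂ a₂₁ a₂₂ : ℝ) :
    ContDiff ℝ 1 fun p : ℝ × ℂ => charFn a₁₁ a₁₂ a₂₁ a₂₂ p.1 p.2 := by
  simp only [charFn_eq]
  have h1 : ContDiff ℝ 1 fun p : ℝ × ℂ => (p.1 : ℂ) := Complex.ofRealCLM.contDiff.comp contDiff_fst
  have h2 : ContDiff ℝ 1 fun p : ℝ × ℂ => Complex.exp (-(p.2 * p.1)) :=
    (contDiff_snd.mul h1).neg.cexp
  fun_prop

lemma continuous_charFn (a₁₁ a₁₂ a₂₁ a₂₂ : ℝ) :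
    Continuous fun p : ℝ × ℂ => charFn a₁₁ a₁₂ a₂₁ a₂₂ p.1 p.2 :=
  (contDiff_charFn a₁₁ a₁₂ a₂₁ a₂₂).continuous

lemma hasDerivAt_charFn (a₁₁ a₁₂ a₂₁ a₂₂ τ : ℝ) (z : ℂ) :
    HasDerivAt (charFn a₁₁ a₁₂ a₂₁ a₂₂ τ)
      ((1 + τ * (a₁₁ * Complex.exp (-(z * τ)))) * (z - a₂₂) +
        (z - a₁₁ * Complex.exp (-(z * τ)))) z := by
  rw [funext (charFn_eq a₁₁ a₁₂ a₂₁ a₂₂ τ)]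
  have h1 : HasDerivAt (fun z : ℂ => Complex.exp (-(z * τ)))
      (Complex.exp (-(z * τ)) * -(1 * τ)) z :=
    ((hasDerivAt_id z).mul_const (τ : ℂ)).neg.cexp
  have h2 := (((hasDerivAt_id z).sub (h1.const_mul (a₁₁ : ℂ))).mul
    ((hasDerivAt_id z).sub_const (a₂₂ : ℂ))).sub_const ((a₁₂ : ℂ) * a₂₁)
  refine h2.congr_deriv ?_
  simp only [id, Pi.sub_apply]
  ring

lemma hasDerivAt_charFn_delay (a₁₁ a₁₂ a₂₁ a₂₂ τ : ℝ) (z : ℂ) :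
    HasDerivAt (fun τ : ℝ => charFn a₁₁ a₁₂ a₂₁ a₂₂ τ z)
      (z * (a₁₁ * Complex.exp (-(z * τ))) * (z - a₂₂)) τ := by
  simp only [charFn_eq]
  have h1 : HasDerivAt (fun τ : ℝ => Complex.exp (-(z * τ)))
      (Complex.exp (-(z * τ)) * -(z * 1)) τ :=
    ((Complex.ofRealCLM.hasDerivAt (x := τ)).const_mul z).neg.cexp
  have h2 := (((h1.const_mul (a₁₁ : ℂ)).const_sub z).mul_const (z - (a₂₂ : ℂ))).sub_const
    ((a₁₂ : ℂ) * a₂₁)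
  refine h2.congr_deriv ?_
  ring

/-- At an imaginary zero the two partial derivatives of the characteristic function satisfy
`re (-∂W/∂τ · conj (∂W/∂z)) > 0`, so that a branch of zeros crosses the imaginary axis from left to
right as the delay grows. -/
lemma crossing_pos (h : |a₁₂ * a₂₁| < |a₁₁ * a₂₂|)
    (h0 : charFn a₁₁ a₁₂ a₂₁ a₂₂ τ (ω * Complex.I) = 0) {u v : ℂ}
    (hu : HasDerivAt (fun τ : ℝ => charFn a₁₁ a₁₂ a₂₁ a₂₂ τ (ω * Complex.I)) u τ)
    (hv : HasDerivAt (charFn a₁₁ a₁₂ a₂₁ a₂₂ τ) v (ω * Complex.I)) :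
    0 < (-u).re * v.re + (-u).im * v.im := by
  have hω := freq_ne_zero h h0
  have hq := freq_quadratic h0
  have hlt := sub_pos.2 (sq_lt_sq_of_abs h)
  rw [hu.unique (hasDerivAt_charFn_delay ..), hv.unique (hasDerivAt_charFn ..)]
  rw [charFn_eq] at h0
  set e := (a₁₁ : ℂ) * Complex.exp (-(ω * Complex.I * τ)) with he
  have hn : e.re ^ 2 + e.im ^ 2 = a₁₁ ^ 2 := by
    have h1 : ‖e‖ = |a₁₁| := by
      rw [he, norm_mul, Complex.norm_exp]
      simp
    rw [← sq_abs a₁₁, ← h1, Complex.sq_norm, Complex.normSq_apply]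
    ring
  rw [Complex.ext_iff] at h0
  simp only [Complex.sub_re, Complex.mul_re, Complex.ofReal_re, Complex.I_re, Complex.ofReal_im,
    Complex.I_im, Complex.sub_im, Complex.mul_im, Complex.zero_re, Complex.zero_im, mul_zero,
    mul_one, sub_zero, zero_sub, add_zero, zero_mul] at h0
  obtain ⟨h1, h2⟩ := h0
  simp only [Complex.sub_re, Complex.mul_re, Complex.ofReal_re, Complex.I_re, Complex.ofReal_im,
    Complex.I_im, Complex.sub_im, Complex.mul_im, Complex.neg_re, Complex.neg_im, Complex.add_re,
    Complex.add_im, Complex.one_re, Complex.one_im, mul_zero,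
    mul_one, sub_zero, zero_sub, add_zero, zero_add, zero_mul]
  generalize e.re = a at *
  generalize e.im = b at *
  have hpr : a * -a₂₂ - b * ω = -(ω ^ 2 + a₁₂ * a₂₁) := by linarith
  have hpi : a * ω + b * -a₂₂ = -(ω * a₂₂) := by linarith
  have key : 0 < ω ^ 4 + ((a₁₁ * a₂₂) ^ 2 - (a₁₂ * a₂₁) ^ 2) := by positivity
  convert key using 1
  linear_combination -(ω * a₂₂) * hpi - 2 * ω ^ 2 * hpr - ω ^ 2 * hn + hq

/-- Through an imaginary zero passes a branch of zeros, which is `C¹` in the delay, crosses the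
imaginary axis from left to right with positive speed, and contains all zeros nearby. -/
lemma exists_branch (h : |a₁₂ * a₂₁| < |a₁₁ * a₂₂|)
    (h0 : charFn a₁₁ a₁₂ a₂₁ a₂₂ τ (ω * Complex.I) = 0) :
    ∃ z : ℝ → ℂ, z τ = ω * Complex.I ∧ ContDiffAt ℝ 1 z τ ∧
      (∀ᶠ s in 𝓝 τ, charFn a₁₁ a₁₂ a₂₁ a₂₂ s (z s) = 0) ∧ 0 < (deriv z τ).re ∧
      ∀ᶠ p : ℝ × ℂ in 𝓝 (τ, ω * Complex.I),
        charFn a₁₁ a₁₂ a₂₁ a₂₂ p.1 p.2 = 0 → z p.1 = p.2 := by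
  set F : ℝ × ℂ → ℂ := fun p => charFn a₁₁ a₁₂ a₂₁ a₂₂ p.1 p.2 with hF
  set p₀ : ℝ × ℂ := (τ, ω * Complex.I) with hp₀
  have hcd : ContDiffAt ℝ 1 F p₀ := (contDiff_charFn a₁₁ a₁₂ a₂₁ a₂₂).contDiffAt
  have hd : HasFDerivAt F (fderiv ℝ F p₀) p₀ := (hcd.differentiableAt one_ne_zero).hasFDerivAt
  have hu := hasDerivAt_charFn_delay a₁₁ a₁₂ a₂₁ a₂₂ τ (ω * Complex.I)
  have hv := hasDerivAt_charFn a₁₁ a₁₂ a₂₁ a₂₂ τ (ω * Complex.I)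
  have hpos := crossing_pos h h0 hu hv
  set u := (ω * Complex.I) * (a₁₁ * Complex.exp (-((ω * Complex.I) * τ))) * ((ω * Complex.I) - a₂₂)
  set v := (1 + τ * (a₁₁ * Complex.exp (-((ω * Complex.I) * τ)))) * ((ω * Complex.I) - a₂₂) +
        ((ω * Complex.I) - a₁₁ * Complex.exp (-((ω * Complex.I) * τ)))
  have hv0 : v ≠ 0 := by
    intro hv0
    simp [hv0] at hpos
  have hinr : ∀ w : ℂ, fderiv ℝ F p₀ (0, w) = v * w := by
    intro w
    have h1 : HasFDerivAt (fun z : ℂ => F (τ, z)) _ (ω * Complex.I) :=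
      hd.comp _ (hasFDerivAt_prodMk_right τ (ω * Complex.I))
    have h2 := h1.unique (hv.hasFDerivAt.restrictScalars ℝ)
    simpa [mul_comm] using DFunLike.congr_fun h2 w
  have hinl : fderiv ℝ F p₀ (1, 0) = u := by
    have h1 : HasFDerivAt (fun s : ℝ => F (s, ω * Complex.I)) _ τ :=
      HasFDerivAt.comp (g := F) (f := fun s : ℝ => (s, (ω : ℂ) * Complex.I)) τ hd
        (hasFDerivAt_prodMk_left τ (ω * Complex.I))
    have h2 := h1.unique hu.hasFDerivAt
    simpa using DFunLike.congr_fun h2 1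
  have hinv : (fderiv ℝ F p₀ ∘L .inr ℝ ℝ ℂ).IsInvertible := by
    refine ⟨ContinuousLinearEquiv.equivOfInverse (fderiv ℝ F p₀ ∘L .inr ℝ ℝ ℂ)
      (ContinuousLinearMap.mul ℝ ℂ v⁻¹) (fun w => ?_) (fun w => ?_), by ext; rfl⟩
    · simp [hinr, hv0]
    · simp [hinr, hv0]
  have hz := hcd.contDiffAt_implicitFunction one_ne_zero hinv
  have hself := hcd.implicitFunction_apply_self one_ne_zero hinv
  have hzero := hcd.eventually_apply_implicitFunction one_ne_zero hinv
  have huniq := hcd.eventually_apply_eq_iff_implicitFunction one_ne_zero hinv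
  set z := hcd.implicitFunction one_ne_zero hinv
  have hFp : F p₀ = 0 := h0
  rw [hFp] at hzero huniq
  refine ⟨z, hself, hz, hzero, ?_, huniq.mono fun p hp => hp.1⟩
  have hz' : HasDerivAt z (deriv z τ) τ := (hz.differentiableAt one_ne_zero).hasDerivAt
  have h1 : HasDerivAt (fun s => F (s, z s)) (fderiv ℝ F p₀ (1, deriv z τ)) τ := by
    have h2 : HasFDerivAt F (fderiv ℝ F p₀) (τ, z τ) := by rw [hself]; exact hd
    exact h2.comp_hasDerivAt τ ((hasDerivAt_id τ).prodMk hz')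
  have h2 : fderiv ℝ F p₀ (1, deriv z τ) = 0 :=
    h1.unique ((hasDerivAt_const τ (0 : ℂ)).congr_of_eventuallyEq hzero)
  have h3 : u + v * deriv z τ = 0 := by
    rw [← hinl, ← hinr, ← map_add]
    simpa using h2
  have h4 : -u = v * deriv z τ := by linear_combination -h3
  rw [h4] at hpos
  simp only [Complex.mul_re, Complex.mul_im] at hpos
  have h5 : 0 < (v.re ^ 2 + v.im ^ 2) * (deriv z τ).re := by linarith
  exact pos_of_mul_pos_right h5 (by positivity)

/-- The zeros in the closed right half-plane are bounded, uniformly in the delay. -/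
lemma norm_le_of_charFn_eq_zero (hτ : 0 ≤ τ) {z : ℂ} (hz : 0 ≤ z.re)
    (h0 : charFn a₁₁ a₁₂ a₂₁ a₂₂ τ z = 0) :
    ‖z‖ ≤ |a₁₁| + |a₂₂| + |a₁₂ * a₂₁| + 1 := by
  by_contra! hc
  rw [charFn_eq, sub_eq_zero] at h0
  have h1 := congrArg norm h0
  rw [norm_mul, ← Complex.ofReal_mul, Complex.norm_real, Real.norm_eq_abs] at h1
  have h2 : ‖(a₁₁ : ℂ) * Complex.exp (-(z * τ))‖ ≤ |a₁₁| := by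
    rw [norm_mul, Complex.norm_exp, Complex.norm_real, Real.norm_eq_abs]
    refine mul_le_of_le_one_right (abs_nonneg _) (Real.exp_le_one_iff.2 ?_)
    simpa using mul_nonneg hz hτ
  have h3 := norm_sub_norm_le z (a₁₁ * Complex.exp (-(z * τ)))
  have h4 := norm_sub_norm_le z (a₂₂ : ℂ)
  rw [Complex.norm_real, Real.norm_eq_abs] at h4
  have := abs_nonneg a₁₁
  have := abs_nonneg a₂₂
  have := abs_nonneg (a₁₂ * a₂₁)
  nlinarith

/-- The half disc that contains all zeros in the closed right half-plane. -/
def rightHalfDisc (a₁₁ a₁₂ a₂₁ a₂₂ : ℝ) : Set ℂ :=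
  Metric.closedBall 0 (|a₁₁| + |a₂₂| + |a₁₂ * a₂₁| + 1) ∩ {z | 0 ≤ z.re}

lemma isCompact_rightHalfDisc (a₁₁ a₁₂ a₂₁ a₂₂ : ℝ) :
    IsCompact (rightHalfDisc a₁₁ a₁₂ a₂₁ a₂₂) :=
  (isCompact_closedBall _ _).inter_right (isClosed_le continuous_const Complex.continuous_re)

lemma mem_rightHalfDisc (hτ : 0 ≤ τ) {z : ℂ} (hz : 0 ≤ z.re)
    (h0 : charFn a₁₁ a₁₂ a₂₁ a₂₂ τ z = 0) : z ∈ rightHalfDisc a₁₁ a₁₂ a₂₁ a₂₂ :=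
  ⟨mem_closedBall_zero_iff.2 (norm_le_of_charFn_eq_zero hτ hz h0), hz⟩

/-- The characteristic function has a zero in the open right half-plane. -/
def HasUnstableRoot (a₁₁ a₁₂ a₂₁ a₂₂ τ : ℝ) : Prop :=
  ∃ z : ℂ, 0 < z.re ∧ charFn a₁₁ a₁₂ a₂₁ a₂₂ τ z = 0

/-- **Persistence of zeros.** An isolated zero of an entire function does not disappear under
small changes of a parameter. -/
lemma eventually_exists_zero {F : ℝ → ℂ → ℂ} (hF : Continuous fun p : ℝ × ℂ => F p.1 p.2)
    (hdiff : ∀ s, Differentiable ℂ (F s)) {t : ℝ} {z₀ : ℂ} (h0 : F t z₀ = 0)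
    (hiso : ∀ᶠ z in 𝓝[≠] z₀, F t z ≠ 0) {ε : ℝ} (hε : 0 < ε) :
    ∀ᶠ s in 𝓝 t, ∃ z ∈ Metric.closedBall z₀ ε, F s z = 0 := by
  obtain ⟨ρ, hρ, hball⟩ := Metric.eventually_nhds_iff_ball.1 (eventually_nhdsWithin_iff.1 hiso)
  obtain ⟨r, hr0, hrρ, hrε⟩ : ∃ r, 0 < r ∧ r < ρ ∧ r ≤ ε :=
    ⟨min (ρ / 2) ε, lt_min (half_pos hρ) hε, (min_le_left _ _).trans_lt (half_lt_self hρ),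
      min_le_right _ _⟩
  have hsph : ∀ z ∈ Metric.sphere z₀ r, F t z ≠ 0 := fun z hz =>
    hball z (by rw [Metric.mem_ball, Metric.mem_sphere.1 hz]; exact hrρ)
      (Metric.ne_of_mem_sphere hz hr0.ne')
  obtain ⟨z₁, hz₁, hmin⟩ := (isCompact_sphere z₀ r).exists_isMinOn
    (NormedSpace.sphere_nonempty.2 hr0.le) (hdiff t).continuous.norm.continuousOn
  obtain ⟨m, hm, hmF⟩ : ∃ m, 0 < m ∧ ∀ z ∈ Metric.sphere z₀ r, m ≤ ‖F t z‖ :=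
    ⟨_, norm_pos_iff.2 (hsph z₁ hz₁), fun z hz => hmin hz⟩
  have hc₀ : Continuous fun s => F s z₀ := hF.comp (continuous_id.prodMk continuous_const)
  have hev1 : ∀ᶠ s in 𝓝 t, ∀ z ∈ Metric.sphere z₀ r, m / 2 < ‖F s z - F s z₀‖ := by
    refine (isCompact_sphere z₀ r).eventually_forall_of_forall_eventually fun z hz => ?_
    refine ((hF.sub (hc₀.comp continuous_fst)).norm.tendsto (t, z)).eventually_const_lt ?_
    simpa [h0] using (half_lt_self hm).trans_le (hmF z hz)
  have hev2 : ∀ᶠ s in 𝓝 t, ‖F s z₀‖ < m / 2 / 2 :=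
    (hc₀.norm.tendsto t).eventually_lt_const (by rw [h0, norm_zero]; positivity)
  filter_upwards [hev1, hev2] with s hs1 hs2
  have hfreq : ∃ᶠ z in 𝓝 z₀, F s z ≠ F s z₀ := by
    intro hcon
    simp only [not_not] at hcon
    have h1 : AnalyticOnNhd ℂ (F s) univ := fun z _ => (hdiff s).analyticAt z
    have h2 : F s z₁ = F s z₀ := h1.eqOn_of_preconnected_of_eventuallyEq (analyticOnNhd_const
      (v := F s z₀)) isPreconnected_univ (mem_univ z₀) hcon (mem_univ z₁)
    have h3 := hs1 z₁ hz₁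
    rw [h2, sub_self, norm_zero] at h3
    linarith
  have hmem : (0 : ℂ) ∈ Metric.ball (F s z₀) (m / 2 / 2) := by
    rw [mem_ball_iff_norm, zero_sub, norm_neg]
    exact hs2
  obtain ⟨z, hz, hz0⟩ := (hdiff s).diffContOnCl.ball_subset_image_closedBall hr0
    (fun z hz => (hs1 z hz).le) hfreq hmem
  exact ⟨z, Metric.closedBall_subset_closedBall hrε hz, hz0⟩

/-- A zero in the open right half-plane persists under small changes of the delay. -/
lemma HasUnstableRoot.eventually (hτ : 0 ≤ τ) (h : HasUnstableRoot a₁₁ a₁₂ a₂₁ a₂₂ τ) :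
    ∀ᶠ s in 𝓝 τ, HasUnstableRoot a₁₁ a₁₂ a₂₁ a₂₂ s := by
  obtain ⟨z₀, hz₀, h0⟩ := h
  have hdiff : ∀ s, Differentiable ℂ (charFn a₁₁ a₁₂ a₂₁ a₂₂ s) :=
    fun s z => (hasDerivAt_charFn a₁₁ a₁₂ a₂₁ a₂₂ s z).differentiableAt
  have han : AnalyticOnNhd ℂ (charFn a₁₁ a₁₂ a₂₁ a₂₂ τ) univ :=
    fun z _ => (hdiff τ).analyticAt z
  -- The function is not identically zero, since its zeros in the right half-plane are bounded.
  have hiso : ∀ᶠ z in 𝓝[≠] z₀, charFn a₁₁ a₁₂ a₂₁ a₂₂ τ z ≠ 0 := by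
    refine (han z₀ (mem_univ _)).eventually_eq_zero_or_eventually_ne_zero.resolve_left fun hz => ?_
    obtain ⟨R, hR⟩ : ∃ R, R = |a₁₁| + |a₂₂| + |a₁₂ * a₂₁| + 1 := ⟨_, rfl⟩
    have hR0 : 0 ≤ R := by rw [hR]; positivity
    have h1 := han.eqOn_zero_of_preconnected_of_eventuallyEq_zero isPreconnected_univ
      (mem_univ _) hz (mem_univ ((R + 1 : ℝ) : ℂ))
    have h2 := norm_le_of_charFn_eq_zero hτ (by rw [Complex.ofReal_re]; linarith) h1
    rw [Complex.norm_real, Real.norm_of_nonneg (by linarith)] at h2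
    linarith
  filter_upwards [eventually_exists_zero (continuous_charFn a₁₁ a₁₂ a₂₁ a₂₂) hdiff h0 hiso
    (half_pos hz₀)] with s ⟨z, hz, hz0⟩
  refine ⟨z, ?_, hz0⟩
  have h1 := (Complex.abs_re_le_norm (z - z₀)).trans (mem_closedBall_iff_norm.1 hz)
  rw [Complex.sub_re] at h1
  linarith [neg_abs_le (z.re - z₀.re)]

/-- Just before a delay at which no zero has positive real part there is no such zero either: it
would have to come close to an imaginary zero, through which the zeros pass from left to right. -/
lemma eventually_left_not_hasUnstableRoot (h : |a₁₂ * a₂₁| < |a₁₁ * a₂₂|) (hτ : 0 < τ)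
    (hu : ¬ HasUnstableRoot a₁₁ a₁₂ a₂₁ a₂₂ τ) :
    ∀ᶠ s in 𝓝[<] τ, ¬ HasUnstableRoot a₁₁ a₁₂ a₂₁ a₂₂ s := by
  have hcont := continuous_charFn a₁₁ a₁₂ a₂₁ a₂₂
  have key : ∀ᶠ s in 𝓝 τ, ∀ z ∈ rightHalfDisc a₁₁ a₁₂ a₂₁ a₂₂,
      s < τ → 0 < z.re → charFn a₁₁ a₁₂ a₂₁ a₂₂ s z ≠ 0 := by
    refine (isCompact_rightHalfDisc a₁₁ a₁₂ a₂₁ a₂₂).eventually_forall_of_forall_eventually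
      fun z hz => ?_
    by_cases h0 : charFn a₁₁ a₁₂ a₂₁ a₂₂ τ z = 0
    · have hre : z.re = 0 := le_antisymm (not_lt.1 fun hlt => hu ⟨z, hlt, h0⟩) hz.2
      have hz' : z = z.im * Complex.I := by
        conv_lhs => rw [← Complex.re_add_im z, hre, Complex.ofReal_zero, zero_add]
      rw [hz'] at h0 ⊢
      obtain ⟨b, hb, hbd, -, hpos, huniq⟩ := exists_branch h h0
      have hder := (Complex.reCLM.hasFDerivAt.comp_hasDerivAt τ
        (hbd.differentiableAt one_ne_zero).hasDerivAt)
      have hneg : ∀ᶠ s in 𝓝 τ, s < τ → (b s).re < 0 := by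
        have h1 := (hasDerivAt_iff_tendsto_slope.1 hder).eventually_const_lt
          (show (0 : ℝ) < Complex.reCLM (deriv b τ) from hpos)
        rw [eventually_nhdsWithin_iff] at h1
        filter_upwards [h1] with s hs hsτ
        have h2 := hs hsτ.ne
        rw [slope_def_field, div_pos_iff] at h2
        simp [hb] at h2
        rcases h2 with h2 | h2
        · linarith
        · exact h2.1
      filter_upwards [huniq, (continuous_fst.tendsto (τ, (z.im : ℂ) * Complex.I)).eventually hneg]
        with p hp1 hp2 hpτ hpre hp0
      have h2 := hp2 hpτ
      rw [hp1 hp0] at h2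
      linarith
    · filter_upwards [hcont.continuousAt.eventually_ne h0] with p hp _ _ using hp
  filter_upwards [nhdsWithin_le_nhds key, self_mem_nhdsWithin,
    nhdsWithin_le_nhds (lt_mem_nhds hτ)] with s hs hsτ hs0
  rintro ⟨z, hz, hz0⟩
  exact hs z (mem_rightHalfDisc hs0.le hz.le hz0) hsτ hz hz0

/-- Zeros cross the imaginary axis only from left to right as the delay grows. -/
theorem HasUnstableRoot.mono (h : |a₁₂ * a₂₁| < |a₁₁ * a₂₂|) {s : ℝ} (hτ : 0 ≤ τ) (hs : τ ≤ s)
    (hu : HasUnstableRoot a₁₁ a₁₂ a₂₁ a₂₂ τ) : HasUnstableRoot a₁₁ a₁₂ a₂₁ a₂₂ s := by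
  by_contra hcon
  -- Consider the first delay at which the zeros with positive real part have disappeared.
  set N := {t | τ ≤ t ∧ ¬ HasUnstableRoot a₁₁ a₁₂ a₂₁ a₂₂ t} with hN
  have hNne : N.Nonempty := ⟨s, hs, hcon⟩
  have hNb : BddBelow N := ⟨τ, fun t ht => ht.1⟩
  set T := sInf N with hT
  have hτT : τ ≤ T := le_csInf hNne fun t ht => ht.1
  have hTu : ¬ HasUnstableRoot a₁₁ a₁₂ a₂₁ a₂₂ T := by
    intro hTu
    have h1 := mem_closure_iff_frequently.1 (csInf_mem_closure hNne hNb)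
    obtain ⟨t, ht, ht'⟩ := (h1.and_eventually (hTu.eventually (hτ.trans hτT))).exists
    exact ht.2 ht'
  have hlt : τ < T := hτT.lt_of_ne fun he => hTu (he ▸ hu)
  obtain ⟨t, ht, htT⟩ := ((eventually_left_not_hasUnstableRoot h (hτ.trans_lt hlt) hTu).and
    (Ioo_mem_nhdsLT hlt)).exists
  exact (csInf_le hNb ⟨htT.1.le, ht⟩).not_gt htT.2

lemma charFn_zero_delay {z : ℂ} : charFn a₁₁ a₁₂ a₂₁ a₂₂ 0 z =
    z ^ 2 - (a₁₁ + a₂₂) * z + (a₁₁ * a₂₂ - a₁₂ * a₂₁) := by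
  rw [charFn_eq]
  simp
  ring

lemma hasUnstableRoot_zero_delay (h : |a₁₂ * a₂₁| < |a₁₁ * a₂₂|) (hn : ¬ (a₁₁ < 0 ∧ a₂₂ < 0)) :
    HasUnstableRoot a₁₁ a₁₂ a₂₁ a₂₂ 0 := by
  obtain ⟨h11, h22⟩ := ne_zero_of_abs h
  set D : ℝ := (a₁₁ + a₂₂) ^ 2 - 4 * (a₁₁ * a₂₂ - a₁₂ * a₂₁) with hD
  rcases lt_or_gt_of_ne (mul_ne_zero h11 h22) with hneg | hpos
  · -- The determinant is negative, hence there is a positive zero.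
    have hdet : a₁₁ * a₂₂ - a₁₂ * a₂₁ < 0 := by
      rw [abs_of_neg hneg] at h
      linarith [neg_abs_le (a₁₂ * a₂₁)]
    have hlt : |a₁₁ + a₂₂| < √D := Real.lt_sqrt_of_sq_lt (by rw [sq_abs]; linarith)
    have hsq : ((√D : ℝ) : ℂ) ^ 2 = D := by
      exact_mod_cast Real.sq_sqrt (by nlinarith [sq_nonneg (a₁₁ + a₂₂)])
    refine ⟨((a₁₁ + a₂₂ + √D : ℝ) : ℂ) / 2, ?_, ?_⟩
    · have := neg_abs_le (a₁₁ + a₂₂)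
      rw [Complex.div_ofNat_re, Complex.ofReal_re]
      linarith
    · rw [charFn_zero_delay]
      push_cast
      rw [hD] at hsq
      push_cast at hsq
      linear_combination hsq / 4
  · -- Both diagonal entries are positive, hence so is the trace.
    have htr : 0 < a₁₁ + a₂₂ := by
      by_contra! hc
      rcases pos_and_pos_or_neg_and_neg_of_mul_pos hpos with h1 | h1
      · linarith
      · exact hn h1
    obtain ⟨c, hc, hc0⟩ : ∃ c : ℂ, c ^ 2 = D ∧ 0 ≤ c.re := by
      obtain ⟨c, hc⟩ := IsAlgClosed.exists_pow_nat_eq (D : ℂ) two_pos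
      rcases le_total 0 c.re with h1 | h1
      · exact ⟨c, hc, h1⟩
      · exact ⟨-c, by rw [neg_sq, hc], by simpa using h1⟩
    refine ⟨(((a₁₁ + a₂₂ : ℝ) : ℂ) + c) / 2, ?_, ?_⟩
    · rw [Complex.div_ofNat_re, Complex.add_re, Complex.ofReal_re]
      linarith
    · rw [charFn_zero_delay]
      rw [hD] at hc
      push_cast at hc ⊢
      linear_combination hc / 4

lemma charFn_zero_delay_ne_zero (h : |a₁₂ * a₂₁| < |a₁₁ * a₂₂|) (h11 : a₁₁ < 0) (h22 : a₂₂ < 0)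
    {z : ℂ} (hz : 0 ≤ z.re) : charFn a₁₁ a₁₂ a₂₁ a₂₂ 0 z ≠ 0 := by
  rw [charFn_zero_delay]
  intro h0
  rw [abs_of_pos (mul_pos_of_neg_of_neg h11 h22)] at h
  have hdet := (le_abs_self _).trans_lt h
  rw [Complex.ext_iff] at h0
  simp [pow_two] at h0
  obtain ⟨h1, h2⟩ := h0
  have him : z.im = 0 := by
    have h3 : (2 * z.re - (a₁₁ + a₂₂)) * z.im = 0 := by linarith
    exact (mul_eq_zero.1 h3).resolve_left (by linarith)
  rw [him] at h1
  nlinarith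

/-- Before the critical delay there are no zeros in the closed right half-plane: the first delay
with such a zero would have an imaginary zero. -/
lemma charFn_ne_zero_of_lt_critDelay (h : |a₁₂ * a₂₁| < |a₁₁ * a₂₂|) (h11 : a₁₁ < 0)
    (h22 : a₂₂ < 0) (hτ : 0 ≤ τ) (hlt : τ < critDelay a₁₁ a₁₂ a₂₁ a₂₂) {z : ℂ} (hz : 0 ≤ z.re) :
    charFn a₁₁ a₁₂ a₂₁ a₂₂ τ z ≠ 0 := by
  intro h0
  have hcont := continuous_charFn a₁₁ a₁₂ a₂₁ a₂₂
  set S := {p : ℝ × ℂ | charFn a₁₁ a₁₂ a₂₁ a₂₂ p.1 p.2 = 0} ∩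
    (Icc 0 τ ×ˢ rightHalfDisc a₁₁ a₁₂ a₂₁ a₂₂) with hS
  have hSc : IsCompact S := (isCompact_Icc.prod (isCompact_rightHalfDisc ..)).inter_left
    (isClosed_eq hcont continuous_const)
  obtain ⟨⟨T, w⟩, ⟨hw0, hT, hw⟩, hmin⟩ := hSc.exists_isMinOn
    ⟨(τ, z), h0, ⟨hτ, le_rfl⟩, mem_rightHalfDisc hτ hz h0⟩ continuous_fst.continuousOn
  change charFn a₁₁ a₁₂ a₂₁ a₂₂ T w = 0 at hw0
  change T ∈ Icc 0 τ at hT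
  change w ∈ rightHalfDisc a₁₁ a₁₂ a₂₁ a₂₂ at hw
  have hT0 : 0 < T := hT.1.lt_of_ne fun he =>
    charFn_zero_delay_ne_zero h h11 h22 hw.2 (by rw [he]; exact hw0)
  have hwre : w.re = 0 := by
    refine le_antisymm (not_lt.1 fun hpos => ?_) hw.2
    have h1 : ∀ᶠ t in 𝓝[<] T, HasUnstableRoot a₁₁ a₁₂ a₂₁ a₂₂ t :=
      nhdsWithin_le_nhds (HasUnstableRoot.eventually hT.1 ⟨w, hpos, hw0⟩)
    obtain ⟨t, ⟨x, hx, hx0⟩, ht⟩ := (h1.and (Ioo_mem_nhdsLT hT0)).exists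
    have h2 : T ≤ t := hmin (show (t, x) ∈ S from
      ⟨hx0, ⟨ht.1.le, ht.2.le.trans hT.2⟩, mem_rightHalfDisc ht.1.le hx.le hx0⟩)
    exact h2.not_gt ht.2
  have hw' : w = w.im * Complex.I := by
    conv_lhs => rw [← Complex.re_add_im w, hwre, Complex.ofReal_zero, zero_add]
  rw [hw'] at hw0
  linarith [critDelay_le h hT.1 hw0, hT.2]

/-! ### The stability switch -/

lemma HasUnstableRoot.isUnstable (h : HasUnstableRoot a₁₁ a₁₂ a₂₁ a₂₂ τ) :
    IsUnstable a₁₁ a₁₂ a₂₁ a₂₂ τ := by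
  obtain ⟨z, hz, h0⟩ := h
  exact isUnstable_of_charFn_eq_zero hz h0

lemma hasUnstableRoot_of_critDelay_lt (h : |a₁₂ * a₂₁| < |a₁₁ * a₂₂|) (h11 : a₁₁ < 0)
    (hτ : critDelay a₁₁ a₁₂ a₂₁ a₂₂ < τ) : HasUnstableRoot a₁₁ a₁₂ a₂₁ a₂₂ τ := by
  obtain ⟨b, hb, hbd, hb0, hpos, -⟩ := exists_branch h (charFn_critDelay h h11)
  have hder := (Complex.reCLM.hasFDerivAt.comp_hasDerivAt _
    (hbd.differentiableAt one_ne_zero).hasDerivAt)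
  have h1 := (hasDerivAt_iff_tendsto_slope.1 hder).eventually_const_lt
    (show (0 : ℝ) < Complex.reCLM (deriv b (critDelay a₁₁ a₁₂ a₂₁ a₂₂)) from hpos)
  obtain ⟨s, ⟨hs1, hs2⟩, hs3⟩ := (((h1.filter_mono (nhdsGT_le_nhdsNE _)).and
    (hb0.filter_mono nhdsWithin_le_nhds)).and (Ioo_mem_nhdsGT hτ)).exists
  have hre : 0 < (b s).re := by
    rw [slope_def_field, lt_div_iff₀ (sub_pos.2 hs3.1)] at hs1
    simpa [hb] using hs1
  exact HasUnstableRoot.mono h ((critDelay_pos h h11).le.trans hs3.1.le) hs3.2.le ⟨b s, hre, hs2⟩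

lemma isHopfBifurcation_critDelay (h : |a₁₂ * a₂₁| < |a₁₁ * a₂₂|) (h11 : a₁₁ < 0) :
    IsHopfBifurcation a₁₁ a₁₂ a₂₁ a₂₂ (critDelay a₁₁ a₁₂ a₂₁ a₂₂)
      (critFreq a₁₁ a₁₂ a₂₁ a₂₂) where
  delay_pos := critDelay_pos h h11
  freq_pos := critFreq_pos h
  root := charFn_critDelay h h11
  simple h0 := by
    have h1 := crossing_pos h (charFn_critDelay h h11) (hasDerivAt_charFn_delay ..)
      (hasDerivAt_charFn ..).differentiableAt.hasDerivAt
    simp [h0] at h1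
  only_roots z hz hre := by
    have hz' : z = z.im * Complex.I := by
      conv_lhs => rw [← Complex.re_add_im z, hre, Complex.ofReal_zero, zero_add]
    rw [hz'] at hz
    rw [hz', ← abs_eq_critFreq h hz]
    rcases abs_choice z.im with h1 | h1
    · left; rw [h1]
    · right; rw [h1]; push_cast; ring
  transversal := by
    obtain ⟨b, hb, hbd, hb0, hpos, -⟩ := exists_branch h (charFn_critDelay h h11)
    exact ⟨b, hb, hbd, hb0, hpos.ne'⟩
  periodic _ hε := exists_periodic_solutions (critFreq_pos h) (charFn_critDelay h h11) hε

end Dyad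

theorem theorem1 (a₁₁ a₁₂ a₂₁ a₂₂ : ℝ) (h : |a₁₂ * a₂₁| < |a₁₁ * a₂₂|) :
    (Dyad.IsUnstable a₁₁ a₁₂ a₂₁ a₂₂ 0 →
      ∀ τ : ℝ, 0 ≤ τ → Dyad.IsUnstable a₁₁ a₁₂ a₂₁ a₂₂ τ) ∧
    (Dyad.IsStable a₁₁ a₁₂ a₂₁ a₂₂ 0 →
      a₁₁ < 0 ∧
      0 < Dyad.critDelay a₁₁ a₁₂ a₂₁ a₂₂ ∧
      (∀ τ₀ : ℝ, Dyad.IsStabilitySwitch a₁₁ a₁₂ a₂₁ a₂₂ τ₀ ↔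
        τ₀ = Dyad.critDelay a₁₁ a₁₂ a₂₁ a₂₂) ∧
      (∀ τ : ℝ, 0 ≤ τ → τ < Dyad.critDelay a₁₁ a₁₂ a₂₁ a₂₂ →
        Dyad.IsStable a₁₁ a₁₂ a₂₁ a₂₂ τ) ∧
      (∀ τ : ℝ, Dyad.critDelay a₁₁ a₁₂ a₂₁ a₂₂ < τ →
        Dyad.IsUnstable a₁₁ a₁₂ a₂₁ a₂₂ τ) ∧
      Dyad.IsHopfBifurcation a₁₁ a₁₂ a₂₁ a₂₂ (Dyad.critDelay a₁₁ a₁₂ a₂₁ a₂₂)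
        (Dyad.critFreq a₁₁ a₁₂ a₂₁ a₂₂)) := by
  constructor
  · intro hu τ hτ
    refine (Dyad.HasUnstableRoot.mono h le_rfl hτ (Dyad.hasUnstableRoot_zero_delay h ?_)).isUnstable
    rintro ⟨h11, h22⟩
    exact (Dyad.isStable_of_charFn_ne_zero le_rfl fun z hz =>
      Dyad.charFn_zero_delay_ne_zero h h11 h22 hz).not_isUnstable le_rfl hu
  · intro hs
    obtain ⟨h11, h22⟩ : a₁₁ < 0 ∧ a₂₂ < 0 := by
      by_contra hn
      exact hs.not_isUnstable le_rfl (Dyad.hasUnstableRoot_zero_delay h hn).isUnstable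
    have hpos := Dyad.critDelay_pos h h11
    have hstab : ∀ τ : ℝ, 0 ≤ τ → τ < Dyad.critDelay a₁₁ a₁₂ a₂₁ a₂₂ →
        Dyad.IsStable a₁₁ a₁₂ a₂₁ a₂₂ τ := fun τ hτ hlt =>
      Dyad.isStable_of_charFn_ne_zero hτ fun z hz =>
        Dyad.charFn_ne_zero_of_lt_critDelay h h11 h22 hτ hlt hz
    have hunst : ∀ τ : ℝ, Dyad.critDelay a₁₁ a₁₂ a₂₁ a₂₂ < τ →
        Dyad.IsUnstable a₁₁ a₁₂ a₂₁ a₂₂ τ := fun τ hτ =>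
      (Dyad.hasUnstableRoot_of_critDelay_lt h h11 hτ).isUnstable
    refine ⟨h11, hpos, fun τ₀ => ⟨fun hsw => ?_, ?_⟩, hstab, hunst,
      Dyad.isHopfBifurcation_critDelay h h11⟩
    · obtain ⟨h0, hsw⟩ := hsw
      rcases lt_trichotomy τ₀ (Dyad.critDelay a₁₁ a₁₂ a₂₁ a₂₂) with hlt | heq | hgt
      · rcases hsw with ⟨-, hu⟩ | ⟨hu, -⟩
        · obtain ⟨τ, hτ, hτ'⟩ := (hu.and (Ioo_mem_nhdsGT hlt)).exists
          have hτ0 := h0.le.trans hτ'.1.le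
          exact ((hstab τ hτ0 hτ'.2).not_isUnstable hτ0 hτ).elim
        · obtain ⟨τ, hτ, hτ'⟩ := (hu.and (Ioo_mem_nhdsLT h0)).exists
          exact ((hstab τ hτ'.1.le (hτ'.2.trans hlt)).not_isUnstable hτ'.1.le hτ).elim
      · exact heq
      · rcases hsw with ⟨hs', -⟩ | ⟨-, hs'⟩
        · obtain ⟨τ, hτ, hτ'⟩ := (hs'.and (Ioo_mem_nhdsLT hgt)).exists
          exact (hτ.not_isUnstable (hpos.le.trans hτ'.1.le) (hunst τ hτ'.1)).elim
        · obtain ⟨τ, hτ, hτ'⟩ := (hs'.and self_mem_nhdsWithin).exists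
          have hlt : Dyad.critDelay a₁₁ a₁₂ a₂₁ a₂₂ < τ := hgt.trans hτ'
          exact (hτ.not_isUnstable (hpos.le.trans hlt.le) (hunst τ hlt)).elim
    · rintro rfl
      refine ⟨hpos, Or.inl ⟨?_, ?_⟩⟩
      · filter_upwards [Ioo_mem_nhdsLT hpos] with τ hτ using hstab τ hτ.1.le hτ.2
      · filter_upwards [self_mem_nhdsWithin] with τ hτ using hunst τ hτ
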